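/- **Setting.** Let $0<\mathfrak n_1<\mathfrak n_2$ and let $\kappa\in\mathbb C$ with $\operatorname{Re}\kappa>0$, $\operatorname{Im}\kappa<0$. Let $y\in W^{2,\infty}_{\mathrm{loc}}(\mathbb R)$ be a nontrivial complex-valued solution (for a.e. $s\in\mathbb R$) of the autonomous equation $$-y''(s)=\kappa^2\,\varepsilon(s)\,y(s),\qquad \varepsilon(s)=\mathfrak n_1^2+(\mathfrak n_2^2-\mathfrak n_1^2)\,\chi_{\mathbb C_+}\big(y^2(s)\big),$$ where $\chi_{\mathbb C_+}$ is the characteristic function of $\mathbb C_+=\{z:\operatorname{Im}z>0\}$. Put $x(s)=\dfrac{y'(s)}{\mathrm i\kappa y(s)}\in\widehat{\mathbb C}=\mathbb C\cup\{\infty\}$, with $x(s)=\infty$ if $y(s)=0$. If $\operatorname{Im}\big(\varepsilon(s)y^2(s)+\kappa^{-2}(y'(s))^2\big)=\lambda_0$ for all $s\in\mathbb R$ with a constant $\lambda_0\ge 0$, then $(x,\varepsilon,\lambda_0,y)$ is called an extended extremal tuple; it is abnormal if $\lambda_0=0$. A point $b\in\mathbb R$ is a switch point of $\varepsilon$ if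 the one-sided limits $\varepsilon(b\pm0)$ exist and $\varepsilon(b-0)\neq\varepsilon(b+0)$. A layer is an interval $I=(b,b')$ whose endpoints $b<b'$ are two consecutive switch points of $\varepsilon$. **Theorem.** Let $(x,\varepsilon,0,y)$ be an extended abnormal extremal tuple, let $I=(b,b')$ be a layer, and let $\epsilon=\varepsilon(b+0)$ be the value of $\varepsilon$ in this layer. Put $\mathcal I(z)=\frac{1-z}{1+z}$, $q=-\frac{\operatorname{Im}\kappa}{\operatorname{Re}\kappa}$ and $q_1=\mathcal I(-e^{-q\pi})$, so that $q_1=\frac{1+e^{-q\pi}}{1-e^{-q\pi}}>1$. (i) If $x[\,\overline I\,]=\{x(s): s\in[b,b']\}$ does not intersect $\mathrm i\widehat{\mathbb R}=\mathrm i\mathbb R\cup\{\infty\}$, then $$b'-b=\frac{\pi}{2\,\epsilon^{1/2}\operatorname{Re}\kappa}\qquad\text{(quarter-wave layer)},$$ and $x(b')=f_{M(\epsilon)}(x(b))$, where $f_{M(\epsilon)}$ is the Möbius transformation of $\widehat{\mathbb C}$ associated with the invertible matrix $$M(\epsilon)=\begin{pmatrix}1&\epsilon^{1/2}q_1\\ \epsilon^{-1/2}q_1&1\end{pmatrix},\qquad\text{i.e.}\quad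 f_{M(\epsilon)}(z)=\frac{z+\epsilon^{1/2}q_1}{\epsilon^{-1/2}q_1z+1}.$$ (ii) If $x(s_0)\in\{0,\infty\}$ for some $s_0\in[b,b']$, then $s_0=(b+b')/2$ and $$b'-b=\frac{\pi}{\epsilon^{1/2}\operatorname{Re}\kappa}\qquad\text{(half-wave layer)};$$ moreover, $-x(b)=x(b')\in(0,\epsilon^{1/2})$ if $x(s_0)=\infty$, and $-x(b)=x(b')\in(\epsilon^{1/2},+\infty)$ if $x(s_0)=0$. -/

import Mathlib

open Filter Topology MeasureTheory

noncomputable section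

namespace LayeredResonator

/-- The feedback control `ℰ(y)(s) = n₁² + (n₂² - n₁²) χ_{ℂ₊}(y(s)²)`, where `ℂ₊` is the open upper
half-plane. -/
def feedbackControl (n₁ n₂ : ℝ) (y : ℝ → ℂ) (s : ℝ) : ℝ :=
  n₁ ^ 2 + (n₂ ^ 2 - n₁ ^ 2) * Set.indicator {z : ℂ | 0 < z.im} (fun _ => (1 : ℝ)) (y s ^ 2)

/-- `y ∈ W^{2,∞}_loc(ℝ)`: the continuously differentiable representative `y` has a locally Lipschitz
derivative. -/
def MemW2InfLoc (y : ℝ → ℂ) : Prop :=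
  Differentiable ℝ y ∧ LocallyLipschitz (deriv y)

/-- `y` is a nontrivial solution on `ℝ` of the autonomous equation `-y'' = κ² y ℰ(y)`. -/
structure IsNontrivialSolution (n₁ n₂ : ℝ) (κ : ℂ) (y : ℝ → ℂ) : Prop where
  memW2InfLoc : MemW2InfLoc y
  equation : ∀ᵐ s ∂(volume : Measure ℝ),
    HasDerivAt (deriv y) (-(κ ^ 2 * y s * (feedbackControl n₁ n₂ y s : ℂ))) s
  nontrivial : ¬ (y =ᵐ[volume] 0)

/-- The Riemann-sphere-valued function `x = y' / (i κ y)`, equal to `∞` at the zeros of `y`. -/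
def riccati (κ : ℂ) (y : ℝ → ℂ) (s : ℝ) : OnePoint ℂ :=
  if y s = 0 then OnePoint.infty else ((deriv y s / (Complex.I * κ * y s) : ℂ) : OnePoint ℂ)

/-- `(x, ε, l₀, y)` is an extended extremal tuple. It is abnormal when `l₀ = 0`. -/
structure IsExtendedExtremalTuple (n₁ n₂ : ℝ) (κ : ℂ)
    (x : ℝ → OnePoint ℂ) (ε : ℝ → ℝ) (l₀ : ℝ) (y : ℝ → ℂ) : Prop where
  solution : IsNontrivialSolution n₁ n₂ κ y
  control_eq : ε = feedbackControl n₁ n₂ y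
  state_eq : x = riccati κ y
  multiplier_nonneg : 0 ≤ l₀
  multiplier_eq : ∀ s : ℝ, ((ε s : ℂ) * y s ^ 2 + (κ ^ 2)⁻¹ * deriv y s ^ 2).im = l₀

/-- `b` is a switch point of `ε`: the one-sided limits `ε(b - 0)` and `ε(b + 0)` exist and differ.
The value `ε(b)` plays no role. -/
def IsSwitchPoint (ε : ℝ → ℝ) (b : ℝ) : Prop :=
  ∃ l r : ℝ, Tendsto ε (𝓝[<] b) (𝓝 l) ∧ Tendsto ε (𝓝[>] b) (𝓝 r) ∧ l ≠ r

/-- `(b, b')` is a layer: `b < b'` are two consecutive switch points of `ε`. -/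
structure IsLayer (ε : ℝ → ℝ) (b b' : ℝ) : Prop where
  lt : b < b'
  switch_left : IsSwitchPoint ε b
  switch_right : IsSwitchPoint ε b'
  no_switch : ∀ s ∈ Set.Ioo b b', ¬ IsSwitchPoint ε s

/-- The extended imaginary axis `iℝ ∪ {∞}` in the Riemann sphere. -/
def extendedImaginaryAxis : Set (OnePoint ℂ) :=
  insert OnePoint.infty (Set.range fun t : ℝ => ((Complex.I * (t : ℂ) : ℂ) : OnePoint ℂ))

/-- The linear fractional involution `z ↦ (1 - z) / (1 + z)`, at real `z ≠ -1`. -/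
def invI (z : ℝ) : ℝ := (1 - z) / (1 + z)

/-- `q = - Im κ / Re κ`. -/
def qParam (κ : ℂ) : ℝ := -(κ.im / κ.re)

/-- `q₁ = ℐ(-e^{-qπ})`. -/
def qOne (κ : ℂ) : ℝ := invI (-Real.exp (-(qParam κ * Real.pi)))

/-- The matrix `M(ϵ)` with rows `(1, ϵ^{1/2} q₁)` and `(ϵ^{-1/2} q₁, 1)`. -/
def transferMatrix (κ : ℂ) (ϵ : ℝ) : Matrix (Fin 2) (Fin 2) ℂ :=
  !![1, ((√ϵ * qOne κ : ℝ) : ℂ);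
    (((√ϵ)⁻¹ * qOne κ : ℝ) : ℂ), 1]

end LayeredResonator

end

/-! Vanishing of the multiplier means that wherever `Im y² = 0`, so that `y² = c` is real, also `y'²
= d κ²` with `d` real. Since `Im κ² < 0`, this forces a dichotomy. If `y` and `y'` are both nonzero
there, then `(y y')² = c d κ²` is not real, so `(Im y²)' = 2 Im (y y') ≠ 0`: the sign of `Im y²`
changes and the point is a switch point. If `y` or `y'` vanishes, `Im y²` has a strict local
extremum and there is no switch. Thus the switch points are exactly the transversal zeros of `Im
y²`, and inside a layer `Im y²` can vanish only where `x` is `0` or `∞`.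

On a layer `ε` is therefore a.e. the constant `ϵ`, and `eq_cos_sin` solves the equation with
frequency `k = √ϵ κ`. Writing `k (s - s₀) = a - i e` with `a`, `e` real, one finds that `Im y²` is a
multiple of `sin 2a`. In (i) take `s₀ = b`, where `x` is real; the other factor cannot vanish at
`b'` because `x(b')` is off the extended imaginary axis, so the layer ends when `a = π/2`. In (ii)
`s₀` is the zero of `y` or `y'`; `Im y²` is a nonzero multiple of `sin 2a · sinh 2e`, and the layer
extends to `a = ±π/2` on either side. At `a = π/2` one has `e = qπ/2`, and `q₁ = coth (qπ/2)` yields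
the values of `x`. -/

namespace LayeredResonator

/-! ### Locally Lipschitz functions of a real variable -/

theorem _root_.LocallyLipschitz.absolutelyContinuousOnInterval {F : Type*} [NormedAddCommGroup F]
    {f : ℝ → F} (hf : LocallyLipschitz f) (a b : ℝ) : AbsolutelyContinuousOnInterval f a b := by
  obtain ⟨K, hK⟩ := (hf.locallyLipschitzOn (s := Set.uIcc a b)).exists_lipschitzOnWith_of_compact
    isCompact_uIcc
  exact hK.absolutelyContinuousOnInterval

theorem ae_ne (c : ℝ) : ∀ᵐ x : ℝ, x ≠ c :=
  compl_mem_ae_iff.mpr (measure_singleton c)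

/-- A locally Lipschitz function is absolutely continuous on compact intervals, hence the integral
of its a.e. derivative. This and the next lemma suit an equation for `y''` that holds only almost
everywhere. -/
theorem _root_.LocallyLipschitz.le_of_ae_deriv_nonneg {f : ℝ → ℝ} (hf : LocallyLipschitz f)
    {a b : ℝ} (hab : a ≤ b)
    (h : ∀ᵐ x, x ∈ Set.Ioo a b → ∃ d, HasDerivAt f d x ∧ 0 ≤ d) : f a ≤ f b := by
  have key := (hf.absolutelyContinuousOnInterval a b).integral_deriv_eq_sub
  have : 0 ≤ ∫ x in a..b, deriv f x := by
    refine intervalIntegral.integral_nonneg_of_ae_restrict hab ?_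
    refine (ae_restrict_iff' measurableSet_Icc).mpr ?_
    filter_upwards [h, ae_ne a, ae_ne b] with x hx ha hb hm
    obtain ⟨d, hd, h0⟩ := hx ⟨lt_of_le_of_ne hm.1 ha.symm, lt_of_le_of_ne hm.2 hb⟩
    simpa [hd.deriv] using h0
  linarith

theorem _root_.LocallyLipschitz.eq_of_ae_deriv_eq_zero {f : ℝ → ℂ} (hf : LocallyLipschitz f)
    {a b : ℝ} (h : ∀ᵐ x, x ∈ Set.Ioo a b → HasDerivAt f 0 x) {s t : ℝ}
    (hs : s ∈ Set.Icc a b) (ht : t ∈ Set.Icc a b) : f s = f t := by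
  have hab : a ≤ b := hs.1.trans hs.2
  obtain ⟨C, hC⟩ := (hf.absolutelyContinuousOnInterval a b).const_of_ae_hasDerivAt_zero (by
    filter_upwards [h, ae_ne a, ae_ne b] with x hx ha hb hm
    rw [Set.uIcc_of_le hab] at hm
    exact hx ⟨lt_of_le_of_ne hm.1 ha.symm, lt_of_le_of_ne hm.2 hb⟩)
  rw [Set.uIcc_of_le hab] at hC
  rw [hC s hs, hC t ht]

/-! ### Functions of the state `(s, y, y')` -/

theorem MemW2InfLoc.hasDerivAt {y : ℝ → ℂ} (hy : MemW2InfLoc y) (s : ℝ) :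
    HasDerivAt y (deriv y s) s := (hy.1 s).hasDerivAt

theorem MemW2InfLoc.continuous {y : ℝ → ℂ} (hy : MemW2InfLoc y) : Continuous y :=
  hy.1.continuous

theorem MemW2InfLoc.continuous_deriv {y : ℝ → ℂ} (hy : MemW2InfLoc y) : Continuous (deriv y) :=
  hy.2.continuous

/-- Makes every smooth energy or conserved quantity built from `(s, y, y')` accessible to the two
preceding a.e. derivative criteria. -/
theorem MemW2InfLoc.locallyLipschitz_comp {E : Type*} [NormedAddCommGroup E] [NormedSpace ℝ E]
    {y : ℝ → ℂ} (hy : MemW2InfLoc y) {F : ℝ × ℂ × ℂ → E} (hF : ContDiff ℝ 1 F) :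
    LocallyLipschitz fun s => F (s, y s, deriv y s) := by
  have h1 : ContDiff ℝ 1 y := contDiff_one_iff_deriv.mpr ⟨hy.1, hy.continuous_deriv⟩
  exact hF.locallyLipschitz.comp
    (LocallyLipschitz.id.prodMk (h1.locallyLipschitz.prodMk hy.2))

/-! ### The feedback control -/

section Control

variable {n₁ n₂ : ℝ} {y : ℝ → ℂ}

theorem feedbackControl_of_pos {s : ℝ} (h : 0 < (y s ^ 2).im) :
    feedbackControl n₁ n₂ y s = n₂ ^ 2 := by
  simp [feedbackControl, Set.indicator_of_mem (show y s ^ 2 ∈ {z : ℂ | 0 < z.im} from h)]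

theorem feedbackControl_of_nonpos {s : ℝ} (h : (y s ^ 2).im ≤ 0) :
    feedbackControl n₁ n₂ y s = n₁ ^ 2 := by
  simp [feedbackControl,
    Set.indicator_of_notMem (show y s ^ 2 ∉ {z : ℂ | 0 < z.im} from not_lt.mpr h)]

theorem sq_le_feedbackControl (h₁ : 0 < n₁) (h₂ : n₁ < n₂) (s : ℝ) :
    n₁ ^ 2 ≤ feedbackControl n₁ n₂ y s := by
  rcases lt_or_ge 0 (y s ^ 2).im with h | h
  · rw [feedbackControl_of_pos h]; gcongr
  · rw [feedbackControl_of_nonpos h]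

theorem feedbackControl_le_sq (h₁ : 0 < n₁) (h₂ : n₁ < n₂) (s : ℝ) :
    feedbackControl n₁ n₂ y s ≤ n₂ ^ 2 := by
  rcases lt_or_ge 0 (y s ^ 2).im with h | h
  · rw [feedbackControl_of_pos h]
  · rw [feedbackControl_of_nonpos h]; gcongr

end Control

/-! ### Unique continuation -/

section Unique

variable {n₁ n₂ : ℝ} {κ : ℂ} {y : ℝ → ℂ}

/-- Two Grönwall bounds in one: `E = |y|² + |y'|²` satisfies `|E'| ≤ (1 + M) E` with `M = |κ|² n₂²`.
The sign `σ = 1` makes `exp((1 + M) s) E` nondecreasing and carries a zero of `E` backwards; `σ =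
-1` makes `exp(-(1 + M) s) E` nonincreasing and carries it forwards. -/
theorem IsNontrivialSolution.norm_sq_exp_growth (h : IsNontrivialSolution n₁ n₂ κ y)
    (h₁ : 0 < n₁) (h₂ : n₁ < n₂) {σ : ℝ} (hσ : σ ^ 2 = 1) {s t : ℝ} (hst : s ≤ t) :
    σ * (Real.exp (σ * (1 + ‖κ‖ ^ 2 * n₂ ^ 2) * s) * (‖y s‖ ^ 2 + ‖deriv y s‖ ^ 2)) ≤
    σ * (Real.exp (σ * (1 + ‖κ‖ ^ 2 * n₂ ^ 2) * t) * (‖y t‖ ^ 2 + ‖deriv y t‖ ^ 2)) := by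
  have hF : ContDiff ℝ 1 (fun p : ℝ × ℂ × ℂ =>
      σ * (Real.exp (σ * (1 + ‖κ‖ ^ 2 * n₂ ^ 2) * p.1) * (‖p.2.1‖ ^ 2 + ‖p.2.2‖ ^ 2))) := by
    have e1 : ContDiff ℝ 1 fun p : ℝ × ℂ × ℂ => ‖p.2.1‖ ^ 2 :=
      (contDiff_norm_sq ℝ).comp (by fun_prop)
    have e2 : ContDiff ℝ 1 fun p : ℝ × ℂ × ℂ => ‖p.2.2‖ ^ 2 :=
      (contDiff_norm_sq ℝ).comp (by fun_prop)
    fun_prop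
  refine (h.memW2InfLoc.locallyLipschitz_comp hF).le_of_ae_deriv_nonneg hst ?_
  filter_upwards [h.equation] with x hx _
  have d1 := (h.memW2InfLoc.hasDerivAt x).norm_sq
  have d2 := hx.norm_sq
  have d3 : HasDerivAt (fun r : ℝ => Real.exp (σ * (1 + ‖κ‖ ^ 2 * n₂ ^ 2) * r)) _ x :=
    ((hasDerivAt_id x).const_mul (σ * (1 + ‖κ‖ ^ 2 * n₂ ^ 2))).exp
  refine ⟨_, (d3.mul (d1.add d2)).const_mul σ, ?_⟩
  set e := feedbackControl n₁ n₂ y x with he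
  have he1 : 0 ≤ e := (sq_nonneg n₁).trans (sq_le_feedbackControl h₁ h₂ x)
  have he2 : e ≤ n₂ ^ 2 := feedbackControl_le_sq h₁ h₂ x
  have b1 := abs_real_inner_le_norm (y x) (deriv y x)
  have b2 := abs_real_inner_le_norm (deriv y x) (-(κ ^ 2 * y x * (e : ℂ)))
  rw [norm_neg, norm_mul, norm_mul, norm_pow, Complex.norm_real, Real.norm_of_nonneg he1] at b2
  set p := ‖y x‖
  set r := ‖deriv y x‖
  set M := ‖κ‖ ^ 2 * n₂ ^ 2 with hM
  have hp : 0 ≤ p := norm_nonneg _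
  have hr : 0 ≤ r := norm_nonneg _
  have b3 : r * (‖κ‖ ^ 2 * p * e) ≤ M * (r * p) := by
    calc r * (‖κ‖ ^ 2 * p * e) = (‖κ‖ ^ 2 * (r * p)) * e := by ring
      _ ≤ (‖κ‖ ^ 2 * (r * p)) * n₂ ^ 2 := by gcongr
      _ = _ := by rw [hM]; ring
  set i1 := inner ℝ (y x) (deriv y x)
  set i2 := inner ℝ (deriv y x) (-(κ ^ 2 * y x * (e : ℂ)))
  have hM0 : 0 ≤ M := by positivity
  have hi : |σ * (2 * i1 + 2 * i2)| ≤ (1 + M) * (p ^ 2 + r ^ 2) := by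
    have hs : |σ| = 1 := by
      have : |σ| ^ 2 = 1 := by rw [sq_abs, hσ]
      nlinarith [abs_nonneg σ]
    rw [abs_mul, hs, one_mul]
    have : |2 * i1 + 2 * i2| ≤ 2 * |i1| + 2 * |i2| := by
      simpa [abs_mul] using abs_add_le (2 * i1) (2 * i2)
    nlinarith [mul_nonneg hM0 (sq_nonneg (p - r)), sq_nonneg (p - r)]
  have hi' := neg_le_of_abs_le hi
  have hE := Real.exp_pos (σ * (1 + M) * x)
  simp only [id, mul_one]
  have : 0 ≤ Real.exp (σ * (1 + M) * x) *
      (σ ^ 2 * (1 + M) * (p ^ 2 + r ^ 2) + σ * (2 * i1 + 2 * i2)) := by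
    rw [hσ]
    exact mul_nonneg hE.le (by linarith)
  refine this.trans_eq ?_
  simp only [Pi.add_apply]
  ring

theorem IsNontrivialSolution.state_ne_zero (h : IsNontrivialSolution n₁ n₂ κ y)
    (h₁ : 0 < n₁) (h₂ : n₁ < n₂) {s : ℝ} (hs : y s = 0) : deriv y s ≠ 0 := by
  intro hs'
  refine h.nontrivial (Eventually.of_forall fun t => ?_)
  have h0 : ‖y s‖ ^ 2 + ‖deriv y s‖ ^ 2 = 0 := by simp [hs, hs']
  suffices ‖y t‖ ^ 2 + ‖deriv y t‖ ^ 2 ≤ 0 by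
    have : ‖y t‖ ^ 2 ≤ 0 := by nlinarith [sq_nonneg ‖deriv y t‖]
    simpa using this.antisymm (sq_nonneg _)
  rcases le_total s t with hst | hst
  · have := h.norm_sq_exp_growth h₁ h₂ (σ := -1) (by norm_num) hst
    rw [h0] at this
    by_contra! hc
    have := mul_pos (Real.exp_pos (-1 * (1 + ‖κ‖ ^ 2 * n₂ ^ 2) * t)) hc
    linarith
  · have := h.norm_sq_exp_growth h₁ h₂ (σ := 1) (by norm_num) hst
    rw [h0] at this
    by_contra! hc
    have := mul_pos (Real.exp_pos (1 * (1 + ‖κ‖ ^ 2 * n₂ ^ 2) * t)) hc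
    linarith

end Unique

/-! ### Local behaviour of `Im y²` for abnormal extremals -/

theorem im_sq_neg {κ : ℂ} (hre : 0 < κ.re) (him : κ.im < 0) : (κ ^ 2).im < 0 := by
  rw [pow_two, Complex.mul_im]
  nlinarith [mul_pos hre (neg_pos.mpr him)]

theorem exists_eq_ofReal {z : ℂ} (hz : z.im = 0) : ∃ c : ℝ, z = c :=
  ⟨z.re, Complex.ext (by simp) (by simpa using hz)⟩

theorem ne_zero_of_re_pos {κ : ℂ} (hre : 0 < κ.re) : κ ≠ 0 := by
  rintro rfl
  simp at hre

/-- A nontrivial solution with `Im (ε y² + κ⁻² y'²) = 0`, together with the standing assumptions on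
the parameters. -/
structure IsAbnormal (n₁ n₂ : ℝ) (κ : ℂ) (y : ℝ → ℂ) : Prop where
  pos : 0 < n₁
  lt : n₁ < n₂
  re_pos : 0 < κ.re
  im_neg : κ.im < 0
  solution : IsNontrivialSolution n₁ n₂ κ y
  multiplier_eq : ∀ s : ℝ,
    ((feedbackControl n₁ n₂ y s : ℂ) * y s ^ 2 + (κ ^ 2)⁻¹ * deriv y s ^ 2).im = 0

namespace IsAbnormal

variable {n₁ n₂ : ℝ} {κ : ℂ} {y : ℝ → ℂ}

theorem kappa_ne_zero (h : IsAbnormal n₁ n₂ κ y) : κ ≠ 0 := ne_zero_of_re_pos h.re_pos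

theorem im_deriv_sq_eq_zero (h : IsAbnormal n₁ n₂ κ y) {s : ℝ} (hs : (y s ^ 2).im = 0) :
    ((κ ^ 2)⁻¹ * deriv y s ^ 2).im = 0 := by
  have := h.multiplier_eq s
  rwa [Complex.add_im, Complex.im_ofReal_mul, hs, mul_zero, zero_add] at this

theorem im_sq_eq_zero_of_deriv (h : IsAbnormal n₁ n₂ κ y) {s : ℝ} (hs : deriv y s = 0) :
    (y s ^ 2).im = 0 := by
  have := h.multiplier_eq s
  rw [Complex.add_im, Complex.im_ofReal_mul, hs] at this
  have hpos : 0 < feedbackControl n₁ n₂ y s :=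
    lt_of_lt_of_le (by have := h.pos; positivity) (sq_le_feedbackControl h.pos h.lt s)
  simpa [hpos.ne'] using this

/-- At a zero of `Im y²` the number `y'²` is a real multiple of `κ²`. -/
theorem exists_deriv_sq_eq (h : IsAbnormal n₁ n₂ κ y) {s : ℝ} (hs : (y s ^ 2).im = 0) :
    ∃ d : ℝ, deriv y s ^ 2 = d * κ ^ 2 := by
  obtain ⟨d, hd⟩ := exists_eq_ofReal (h.im_deriv_sq_eq_zero hs)
  refine ⟨d, ?_⟩
  rw [← hd]
  have := h.kappa_ne_zero
  field_simp

/-- If `y y'` were real, so would be its square `c d κ²` with `c d` real and nonzero, contradicting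
`Im κ² < 0`. This is the transversality behind every switch. -/
theorem im_mul_deriv_ne_zero (h : IsAbnormal n₁ n₂ κ y) {s : ℝ} (hs : (y s ^ 2).im = 0)
    (h0 : y s ≠ 0) (h1 : deriv y s ≠ 0) : (y s * deriv y s).im ≠ 0 := by
  intro him
  obtain ⟨d, hd⟩ := h.exists_deriv_sq_eq hs
  obtain ⟨c, hc⟩ := exists_eq_ofReal hs
  have hc0 : c ≠ 0 := by
    rintro rfl
    exact h0 (by simpa using hc)
  have hd0 : d ≠ 0 := by
    rintro rfl
    exact h1 (by simpa using hd)
  have e : (y s * deriv y s) ^ 2 = ((c * d : ℝ) : ℂ) * κ ^ 2 := by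
    rw [mul_pow, hc, hd]; push_cast; ring
  have e2 : ((y s * deriv y s) ^ 2).im = 0 := by
    rw [pow_two, Complex.mul_im, him]; ring
  rw [e, Complex.im_ofReal_mul] at e2
  exact (mul_ne_zero (mul_ne_zero hc0 hd0) (im_sq_neg h.re_pos h.im_neg).ne) e2

theorem hasDerivAt_im_sq (h : IsAbnormal n₁ n₂ κ y) (s : ℝ) :
    HasDerivAt (fun t => (y t ^ 2).im) (2 * (y s * deriv y s).im) s := by
  have h2 : HasDerivAt (fun t => (y t ^ 2).im) 
      (Complex.imCLM ((2 : ℕ) * y s ^ (2 - 1) * deriv y s)) s :=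
    Complex.imCLM.hasFDerivAt.comp_hasDerivAt s ((h.solution.memW2InfLoc.hasDerivAt s).pow 2)
  convert h2 using 1
  simp [mul_assoc]

theorem continuous_im_sq (h : IsAbnormal n₁ n₂ κ y) : Continuous fun t => (y t ^ 2).im :=
  Complex.continuous_im.comp (h.solution.memW2InfLoc.continuous.pow 2)

/-- At a zero of `y` the function `Im y²` has a strict local extremum. -/
theorem eventually_sign_of_eq_zero (h : IsAbnormal n₁ n₂ κ y) {s : ℝ} (hs : y s = 0) :
    ∃ c : ℝ, ∀ᶠ t in 𝓝[≠] s, 0 < c * (y t ^ 2).im := by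
  have h1 : deriv y s ≠ 0 := h.solution.state_ne_zero h.pos h.lt hs
  obtain ⟨d, hd⟩ := h.exists_deriv_sq_eq (s := s) (by simp [hs])
  have hd0 : d ≠ 0 := by
    rintro rfl
    exact h1 (by simpa using hd)
  have hne : (deriv y s ^ 2).im ≠ 0 := by
    rw [hd, Complex.im_ofReal_mul]
    exact mul_ne_zero hd0 (im_sq_neg h.re_pos h.im_neg).ne
  refine ⟨(deriv y s ^ 2).im, ?_⟩
  -- As `y s = 0`, `Im y(t)²` is `(t - s)²` times the imaginary part of the squared slope, which
  -- tends to `Im y'(s)² = d Im κ² ≠ 0`.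
  have hslope := hasDerivAt_iff_tendsto_slope.mp (h.solution.memW2InfLoc.hasDerivAt s)
  have htend : Tendsto (fun t => (deriv y s ^ 2).im * (slope y s t ^ 2).im) (𝓝[≠] s)
      (𝓝 ((deriv y s ^ 2).im * (deriv y s ^ 2).im)) :=
    ((Complex.continuous_im.tendsto _).comp (hslope.pow 2)).const_mul _
  filter_upwards [htend.eventually_const_lt (mul_self_pos.mpr hne), self_mem_nhdsWithin]
    with t ht htne
  have hts : t - s ≠ 0 := sub_ne_zero.mpr htne
  have e : y t ^ 2 = (((t - s) ^ 2 : ℝ) : ℂ) * slope y s t ^ 2 := by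
    have : (t : ℂ) - s ≠ 0 := by exact_mod_cast hts
    rw [slope_def_module, hs, sub_zero, Complex.real_smul]
    push_cast
    field_simp
  rw [e, Complex.im_ofReal_mul]
  have := mul_pos (sq_pos_of_ne_zero hts) ht
  linarith

/-- At a critical point of `y` the function `Im y²` has a strict local extremum. -/
theorem eventually_sign_of_deriv_eq_zero (h : IsAbnormal n₁ n₂ κ y) {s : ℝ}
    (hs : deriv y s = 0) : ∃ c : ℝ, ∀ᶠ t in 𝓝[≠] s, 0 < c * (y t ^ 2).im := by
  have hf := h.im_sq_eq_zero_of_deriv hs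
  have h0 : y s ≠ 0 := fun h0 => h.solution.state_ne_zero h.pos h.lt h0 hs
  obtain ⟨c, hc⟩ := exists_eq_ofReal hf
  have hc0 : c ≠ 0 := by
    rintro rfl
    exact h0 (by simpa using hc)
  have hK := im_sq_neg h.re_pos h.im_neg
  -- The second-derivative test: a.e. `c (Im (y y'))' = c Im y'² - ε c Im (κ² y²)`. At `s` the first
  -- term is `0` and `-c Im (κ² y²)` equals `J₀ > 0`. Since `ε` may jump, only the bound `ε ≥ n₁²`
  -- is used.
  set J₀ : ℝ := -(c ^ 2 * (κ ^ 2).im) with hJ₀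
  have hJ₀pos : 0 < J₀ := by
    have : 0 < c ^ 2 := by positivity
    nlinarith
  have hn : 0 < n₁ ^ 2 := by have := h.pos; positivity
  have cy := h.solution.memW2InfLoc.continuous
  have cy' := h.solution.memW2InfLoc.continuous_deriv
  have ev1 : ∀ᶠ t in 𝓝 s, J₀ / 2 < -(c * (κ ^ 2 * y t ^ 2).im) := by
    have ct : Continuous fun t => -(c * (κ ^ 2 * y t ^ 2).im) := by fun_prop
    refine (ct.tendsto s).eventually_const_lt ?_
    rw [hc, mul_comm (κ ^ 2), Complex.im_ofReal_mul]
    calc J₀ / 2 < J₀ := by linarith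
      _ = _ := by rw [hJ₀]; ring
  have ev2 : ∀ᶠ t in 𝓝 s, -(n₁ ^ 2 * J₀ / 4) < c * (deriv y t ^ 2).im := by
    have ct : Continuous fun t => c * (deriv y t ^ 2).im := by fun_prop
    refine (ct.tendsto s).eventually_const_lt ?_
    rw [hs]
    simpa using by positivity
  obtain ⟨δ, hδ, hball⟩ := Metric.eventually_nhds_iff.mp (ev1.and ev2)
  -- Near `s` the derivative of `c Im (y y')` is at least `n₁² J₀ / 2 - n₁² J₀ / 4 = m`, so
  -- subtracting `m t` leaves a nondecreasing function. As `c Im (y y')` vanishes at `s`, it is at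
  -- least `m (t - s)` on the right and at most that on the left.
  set m : ℝ := n₁ ^ 2 * J₀ / 4 with hm
  have hmpos : 0 < m := by positivity
  have hF : ContDiff ℝ 1 fun p : ℝ × ℂ × ℂ => c * (p.2.1 * p.2.2).im - m * p.1 := by
    have e1 : ContDiff ℝ 1 fun p : ℝ × ℂ × ℂ => (p.2.1 * p.2.2).im :=
      Complex.imCLM.contDiff.comp
        (by fun_prop : ContDiff ℝ 1 fun p : ℝ × ℂ × ℂ => p.2.1 * p.2.2)
    fun_prop
  have hLip := h.solution.memW2InfLoc.locallyLipschitz_comp hF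
  have hmono : ∀ u v : ℝ, u ≤ v → s - δ ≤ u → v ≤ s + δ →
      c * (y u * deriv y u).im - m * u ≤ c * (y v * deriv y v).im - m * v := by
    intro u v huv hu hv
    refine hLip.le_of_ae_deriv_nonneg huv ?_
    filter_upwards [h.solution.equation] with t ht hmem
    obtain ⟨b1, b2⟩ := hball (y := t) (by
      rw [Real.dist_eq, abs_lt]; constructor <;> linarith [hmem.1, hmem.2])
    have d1 := (h.solution.memW2InfLoc.hasDerivAt t).mul ht
    have d2 : HasDerivAt (fun r => (y r * deriv y r).im)
        (deriv y t * deriv y t + y t * -(κ ^ 2 * y t * (feedbackControl n₁ n₂ y t : ℂ))).im t :=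
      Complex.imCLM.hasFDerivAt.comp_hasDerivAt t d1
    refine ⟨_, (d2.const_mul c).sub ((hasDerivAt_id t).const_mul m), ?_⟩
    have he := sq_le_feedbackControl (y := y) h.pos h.lt t
    have e : deriv y t * deriv y t + y t * -(κ ^ 2 * y t * (feedbackControl n₁ n₂ y t : ℂ)) =
        deriv y t ^ 2 - (feedbackControl n₁ n₂ y t : ℂ) * (κ ^ 2 * y t ^ 2) := by ring
    rw [e, Complex.sub_im, Complex.im_ofReal_mul]
    nlinarith [mul_le_mul he b1.le (by positivity) (hn.le.trans he)]
  refine ⟨c, ?_⟩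
  have hcont : ∀ S : Set ℝ, ContinuousOn (fun t => c * (y t ^ 2).im) S := fun S =>
    (continuous_const.mul h.continuous_im_sq).continuousOn
  have hder : ∀ t, deriv (fun t => c * (y t ^ 2).im) t = 2 * (c * (y t * deriv y t).im) := by
    intro t
    rw [((h.hasDerivAt_im_sq t).const_mul c).deriv]; ring
  have hat : c * (y s * deriv y s).im = 0 := by simp [hs]
  have hright : StrictMonoOn (fun t => c * (y t ^ 2).im) (Set.Icc s (s + δ)) := by
    refine strictMonoOn_of_deriv_pos (convex_Icc _ _) (hcont _) fun t ht => ?_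
    rw [interior_Icc] at ht
    have := hmono s t ht.1.le (by linarith) ht.2.le
    rw [hder]
    nlinarith [mul_pos hmpos (sub_pos.mpr ht.1)]
  have hleft : StrictAntiOn (fun t => c * (y t ^ 2).im) (Set.Icc (s - δ) s) := by
    refine strictAntiOn_of_deriv_neg (convex_Icc _ _) (hcont _) fun t ht => ?_
    rw [interior_Icc] at ht
    have := hmono t s ht.2.le ht.1.le (by linarith)
    rw [hder]
    nlinarith [mul_pos hmpos (sub_pos.mpr ht.2)]
  have hfs : c * (y s ^ 2).im = 0 := by rw [hf, mul_zero]
  filter_upwards [self_mem_nhdsWithin, nhdsWithin_le_nhds (Metric.ball_mem_nhds s hδ)]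
    with t htne htb
  rw [Metric.mem_ball, Real.dist_eq, abs_lt] at htb
  rw [← hfs]
  rcases lt_or_gt_of_ne (show t ≠ s from htne) with hlt | hgt
  · exact hleft ⟨by linarith, hlt.le⟩ ⟨by linarith, le_rfl⟩ hlt
  · exact hright ⟨le_rfl, by linarith⟩ ⟨hgt.le, by linarith⟩ hgt

/-- Near each point, either `Im y²` keeps a strict sign, or it crosses zero transversally. -/
theorem eventually_sign_or (h : IsAbnormal n₁ n₂ κ y) (s : ℝ) :
    (∀ᶠ t in 𝓝[≠] s, 0 < (y t ^ 2).im) ∨ (∀ᶠ t in 𝓝[≠] s, (y t ^ 2).im < 0) ∨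
      ((y s ^ 2).im = 0 ∧ y s ≠ 0 ∧ deriv y s ≠ 0) := by
  have aux : (∃ c : ℝ, ∀ᶠ t in 𝓝[≠] s, 0 < c * (y t ^ 2).im) →
      (∀ᶠ t in 𝓝[≠] s, 0 < (y t ^ 2).im) ∨ (∀ᶠ t in 𝓝[≠] s, (y t ^ 2).im < 0) := by
    rintro ⟨c, hc⟩
    rcases le_or_gt c 0 with h0 | h0
    · right
      filter_upwards [hc] with t ht
      by_contra! hge
      exact absurd ht (not_lt.mpr (mul_nonpos_of_nonpos_of_nonneg h0 hge))
    · left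
      filter_upwards [hc] with t ht
      exact (mul_pos_iff_of_pos_left h0).mp ht
  by_cases h0 : y s = 0
  · exact (aux (h.eventually_sign_of_eq_zero h0)).imp_right Or.inl
  by_cases h1 : deriv y s = 0
  · exact (aux (h.eventually_sign_of_deriv_eq_zero h1)).imp_right Or.inl
  rcases lt_trichotomy (y s ^ 2).im 0 with hf | hf | hf
  · exact Or.inr (Or.inl (nhdsWithin_le_nhds
      ((h.continuous_im_sq.tendsto s).eventually_lt_const hf)))
  · exact Or.inr (Or.inr ⟨hf, h0, h1⟩)
  · exact Or.inl (nhdsWithin_le_nhds ((h.continuous_im_sq.tendsto s).eventually_const_lt hf))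

theorem tendsto_control_of_pos {l : Filter ℝ} (hl : ∀ᶠ t in l, 0 < (y t ^ 2).im) :
    Tendsto (feedbackControl n₁ n₂ y) l (𝓝 (n₂ ^ 2)) :=
  tendsto_const_nhds.congr' (hl.mono fun _ ht => (feedbackControl_of_pos ht).symm)

theorem tendsto_control_of_neg {l : Filter ℝ} (hl : ∀ᶠ t in l, (y t ^ 2).im < 0) :
    Tendsto (feedbackControl n₁ n₂ y) l (𝓝 (n₁ ^ 2)) :=
  tendsto_const_nhds.congr' (hl.mono fun _ ht => (feedbackControl_of_nonpos ht.le).symm)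

/-- If `Im y²` has one strict sign on both sides of `b`, the one-sided limits of the control agree.
With the converse `isSwitchPoint`, this identifies switch points with transversal zeros. -/
theorem nonzero_of_isSwitchPoint (h : IsAbnormal n₁ n₂ κ y) {b : ℝ}
    (hb : IsSwitchPoint (feedbackControl n₁ n₂ y) b) :
    (y b ^ 2).im = 0 ∧ y b ≠ 0 ∧ deriv y b ≠ 0 := by
  obtain ⟨l, r, hl, hr, hne⟩ := hb
  rcases h.eventually_sign_or b with hp | hn | h0
  · exact absurd ((tendsto_nhds_unique hl
      ((tendsto_control_of_pos hp).mono_left (nhdsLT_le_nhdsNE b))).trans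
      (tendsto_nhds_unique hr
      ((tendsto_control_of_pos hp).mono_left (nhdsGT_le_nhdsNE b))).symm) hne
  · exact absurd ((tendsto_nhds_unique hl
      ((tendsto_control_of_neg hn).mono_left (nhdsLT_le_nhdsNE b))).trans
      (tendsto_nhds_unique hr
      ((tendsto_control_of_neg hn).mono_left (nhdsGT_le_nhdsNE b))).symm) hne
  · exact h0

/-- `Im y²` changes sign at its transversal zeros. -/
theorem eventually_crossing (h : IsAbnormal n₁ n₂ κ y) {s : ℝ} (hs : (y s ^ 2).im = 0)
    (h0 : y s ≠ 0) (h1 : deriv y s ≠ 0) :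
    ((∀ᶠ t in 𝓝[<] s, (y t ^ 2).im < 0) ∧ ∀ᶠ t in 𝓝[>] s, 0 < (y t ^ 2).im) ∨
    ((∀ᶠ t in 𝓝[<] s, 0 < (y t ^ 2).im) ∧ ∀ᶠ t in 𝓝[>] s, (y t ^ 2).im < 0) := by
  have hd := (h.hasDerivAt_im_sq s).deriv
  rcases lt_or_gt_of_ne (h.im_mul_deriv_ne_zero hs h0 h1) with hneg | hpos
  · right
    have ev := eventually_nhdsWithin_sign_eq_of_deriv_neg (f := fun t => (y t ^ 2).im)
      (by rw [hd]; linarith) hs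
    constructor
    · filter_upwards [nhdsWithin_le_nhds ev, self_mem_nhdsWithin] with t ht hlt
      rwa [sign_pos (sub_pos.mpr hlt), sign_eq_one_iff] at ht
    · filter_upwards [nhdsWithin_le_nhds ev, self_mem_nhdsWithin] with t ht hlt
      rwa [sign_neg (sub_neg.mpr hlt), sign_eq_neg_one_iff] at ht
  · left
    have ev := eventually_nhdsWithin_sign_eq_of_deriv_pos (f := fun t => (y t ^ 2).im)
      (by rw [hd]; linarith) hs
    constructor
    · filter_upwards [nhdsWithin_le_nhds ev, self_mem_nhdsWithin] with t ht hlt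
      rwa [sign_neg (sub_neg.mpr hlt), sign_eq_neg_one_iff] at ht
    · filter_upwards [nhdsWithin_le_nhds ev, self_mem_nhdsWithin] with t ht hlt
      rwa [sign_pos (sub_pos.mpr hlt), sign_eq_one_iff] at ht

theorem isSwitchPoint (h : IsAbnormal n₁ n₂ κ y) {s : ℝ} (hs : (y s ^ 2).im = 0)
    (h0 : y s ≠ 0) (h1 : deriv y s ≠ 0) : IsSwitchPoint (feedbackControl n₁ n₂ y) s := by
  have hne : n₁ ^ 2 < n₂ ^ 2 := by
    have := h.pos; have := h.lt; gcongr
  rcases h.eventually_crossing hs h0 h1 with ⟨hl, hr⟩ | ⟨hl, hr⟩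
  · exact ⟨_, _, tendsto_control_of_neg hl, tendsto_control_of_pos hr, hne.ne⟩
  · exact ⟨_, _, tendsto_control_of_pos hl, tendsto_control_of_neg hr, hne.ne'⟩

/-! ### Layers -/

theorem eq_zero_or_deriv_eq_zero_of_mem_layer (h : IsAbnormal n₁ n₂ κ y) {b b' : ℝ}
    (hI : IsLayer (feedbackControl n₁ n₂ y) b b') {s : ℝ} (hs : s ∈ Set.Ioo b b')
    (hf : (y s ^ 2).im = 0) : y s = 0 ∨ deriv y s = 0 := by
  by_contra! hc
  exact hI.no_switch s hs (h.isSwitchPoint hf hc.1 hc.2)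

/-- Connectedness: "positive on a punctured neighbourhood" and "negative on a punctured
neighbourhood" define disjoint open sets, and without switch points they cover the layer. Punctured
neighbourhoods are needed because `Im y²` may touch zero inside. -/
theorem eventually_pos_or_neg_of_layer (h : IsAbnormal n₁ n₂ κ y) {b b' : ℝ}
    (hI : IsLayer (feedbackControl n₁ n₂ y) b b') :
    (∀ s ∈ Set.Ioo b b', ∀ᶠ t in 𝓝[≠] s, 0 < (y t ^ 2).im) ∨
    (∀ s ∈ Set.Ioo b b', ∀ᶠ t in 𝓝[≠] s, (y t ^ 2).im < 0) := by
  have hor : ∀ s ∈ Set.Ioo b b', (∀ᶠ t in 𝓝[≠] s, 0 < (y t ^ 2).im) ∨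
      ∀ᶠ t in 𝓝[≠] s, (y t ^ 2).im < 0 := by
    intro s hs
    rcases h.eventually_sign_or s with hp | hn | ⟨hf, h0, h1⟩
    · exact Or.inl hp
    · exact Or.inr hn
    · exact absurd (h.isSwitchPoint hf h0 h1) (hI.no_switch s hs)
  have hopen : ∀ V : Set ℝ, IsOpen V →
      IsOpen {s | ∀ᶠ t in 𝓝[≠] s, (y t ^ 2).im ∈ V} := by
    intro V hV
    rw [isOpen_iff_mem_nhds]
    intro s hs
    have hs' : ∀ᶠ t in 𝓝[≠] s, (y t ^ 2).im ∈ V := hs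
    have h2 : ∀ᶠ t in 𝓝[≠] s, ∀ᶠ u in 𝓝[≠] t, (y u ^ 2).im ∈ V :=
      hs'.mono fun t ht => nhdsWithin_le_nhds
        ((h.continuous_im_sq.tendsto t).eventually_mem (hV.mem_nhds ht))
    rw [eventually_nhdsWithin_iff] at h2
    filter_upwards [h2] with t ht
    by_cases hts : t = s
    · exact hts ▸ hs
    · exact ht hts
  have hdis : ∀ s, (∀ᶠ t in 𝓝[≠] s, 0 < (y t ^ 2).im) →
      ¬ ∀ᶠ t in 𝓝[≠] s, (y t ^ 2).im < 0 := fun s hp hn => by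
    obtain ⟨t, ht⟩ := (hp.and hn).exists
    exact lt_asymm ht.1 ht.2
  by_cases hex : ∃ s ∈ Set.Ioo b b', ∀ᶠ t in 𝓝[≠] s, 0 < (y t ^ 2).im
  · left
    intro u hu
    rcases hor u hu with hp | hn
    · exact hp
    · obtain ⟨s, hs, hp⟩ := hex
      obtain ⟨v, -, hv1, hv2⟩ := isPreconnected_Ioo (a := b) (b := b') _ _
        (hopen (Set.Ioi 0) isOpen_Ioi) (hopen (Set.Iio 0) isOpen_Iio) (fun r hr => hor r hr)
        ⟨s, hs, hp⟩ ⟨u, hu, hn⟩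
      exact absurd hv2 (hdis v hv1)
  · right
    intro u hu
    exact (hor u hu).resolve_left fun hp => hex ⟨u, hu, hp⟩

theorem ae_control_eq_of_layer (h : IsAbnormal n₁ n₂ κ y) {b b' ϵ : ℝ}
    (hI : IsLayer (feedbackControl n₁ n₂ y) b b')
    (hϵ : Tendsto (feedbackControl n₁ n₂ y) (𝓝[>] b) (𝓝 ϵ)) :
    0 < ϵ ∧ ∀ᵐ s, s ∈ Set.Ioo b b' → feedbackControl n₁ n₂ y s = ϵ := by
  have hp1 := h.pos
  have hp2 := h.pos.trans h.lt
  have hae : ∀ v : ℝ, (∀ s ∈ Set.Ioo b b', ∀ᶠ t in 𝓝[≠] s, feedbackControl n₁ n₂ y t = v) →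
      ∀ᵐ s, s ∈ Set.Ioo b b' → feedbackControl n₁ n₂ y s = v := by
    intro v hv
    rw [ae_iff]
    -- The exceptional points are isolated within the exceptional set, so that set is locally a
    -- singleton.
    refine measure_null_of_locally_null _ fun s hs => ?_
    simp only [Set.mem_ofPred_eq, Classical.not_imp] at hs
    refine ⟨{s}, ?_, measure_singleton s⟩
    have := hv s hs.1
    rw [eventually_nhdsWithin_iff] at this
    filter_upwards [nhdsWithin_le_nhds this, self_mem_nhdsWithin] with t ht htm
    simp only [Classical.not_imp] at htm
    by_contra hts
    exact htm.2 (ht hts)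
  have hlim : ∀ v : ℝ, (∀ s ∈ Set.Ioo b b', ∀ᶠ t in 𝓝[≠] s, feedbackControl n₁ n₂ y t = v) →
      ϵ = v := by
    intro v hv
    -- Interior points arbitrarily close to `b` have nearby points where the control equals `v`,
    -- which is incompatible with a right limit other than `v`.
    by_contra hne
    have ev : ∀ᶠ t in 𝓝[>] b, feedbackControl n₁ n₂ y t ≠ v := hϵ.eventually_ne hne
    obtain ⟨u, hu, hsub⟩ := (mem_nhdsGT_iff_exists_Ioo_subset).mp ev
    have hlt : b < min u b' := lt_min hu hI.lt
    obtain ⟨s, hs1, hs2⟩ := exists_between hlt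
    have hsu : s < u := hs2.trans_le (min_le_left _ _)
    have hsb : s < b' := hs2.trans_le (min_le_right _ _)
    have hmem : ∀ᶠ t in 𝓝[≠] s, t ∈ Set.Ioo b u :=
      nhdsWithin_le_nhds (isOpen_Ioo.mem_nhds ⟨hs1, hsu⟩)
    obtain ⟨t, ht1, ht2⟩ := (hmem.and (hv s ⟨hs1, hsb⟩)).exists
    exact hsub ht1 ht2
  rcases h.eventually_pos_or_neg_of_layer hI with hp | hn
  · have hv := fun s hs => (hp s hs).mono fun t ht => feedbackControl_of_pos (n₁ := n₁) (n₂ := n₂) ht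
    rw [hlim _ hv]
    exact ⟨by positivity, hae _ hv⟩
  · have hv := fun s hs => (hn s hs).mono fun t ht =>
      feedbackControl_of_nonpos (n₁ := n₁) (n₂ := n₂) (le_of_lt ht)
    rw [hlim _ hv]
    exact ⟨by positivity, hae _ hv⟩

end IsAbnormal

/-! ### Solutions on a layer -/

/-- Rotating `(y, y'/k)` back by the angle `k (s - s₀)` gives two locally Lipschitz quantities with
a.e. zero derivative. They keep their values at `s₀`, and undoing the rotation gives the formulas.
-/
theorem MemW2InfLoc.eq_cos_sin {y : ℝ → ℂ} (hy : MemW2InfLoc y) {k : ℂ} (hk : k ≠ 0) {b b' : ℝ}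
    (heq : ∀ᵐ s, s ∈ Set.Ioo b b' → HasDerivAt (deriv y) (-(k ^ 2 * y s)) s) {s₀ s : ℝ}
    (hs₀ : s₀ ∈ Set.Icc b b') (hs : s ∈ Set.Icc b b') :
    y s = y s₀ * Complex.cos (k * (s - s₀ : ℝ)) +
        deriv y s₀ / k * Complex.sin (k * (s - s₀ : ℝ)) ∧
      deriv y s = k * (deriv y s₀ / k * Complex.cos (k * (s - s₀ : ℝ)) -
        y s₀ * Complex.sin (k * (s - s₀ : ℝ))) := by
  have hlin : ContDiff ℝ 1 fun p : ℝ × ℂ × ℂ => k * ((p.1 - s₀ : ℝ) : ℂ) :=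
    contDiff_const.mul (Complex.ofRealCLM.contDiff.comp
      (by fun_prop : ContDiff ℝ 1 fun p : ℝ × ℂ × ℂ => p.1 - s₀))
  have hcos : ContDiff ℝ 1 fun p : ℝ × ℂ × ℂ => Complex.cos (k * ((p.1 - s₀ : ℝ) : ℂ)) :=
    (Complex.contDiff_cos.restrict_scalars ℝ).comp hlin
  have hsin : ContDiff ℝ 1 fun p : ℝ × ℂ × ℂ => Complex.sin (k * ((p.1 - s₀ : ℝ) : ℂ)) :=
    (Complex.contDiff_sin.restrict_scalars ℝ).comp hlin
  have dlin : ∀ t : ℝ, HasDerivAt (fun t : ℝ => k * ((t - s₀ : ℝ) : ℂ)) k t := fun t => by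
    simpa using (((hasDerivAt_id t).sub_const s₀).ofReal_comp.const_mul k)
  have dcos : ∀ t : ℝ, HasDerivAt (fun t : ℝ => Complex.cos (k * ((t - s₀ : ℝ) : ℂ)))
      (-Complex.sin (k * ((t - s₀ : ℝ) : ℂ)) * k) t := fun t => (Complex.hasDerivAt_cos _).comp t (dlin t)
  have dsin : ∀ t : ℝ, HasDerivAt (fun t : ℝ => Complex.sin (k * ((t - s₀ : ℝ) : ℂ)))
      (Complex.cos (k * ((t - s₀ : ℝ) : ℂ)) * k) t := fun t => (Complex.hasDerivAt_sin _).comp t (dlin t)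
  have E₁ := (hy.locallyLipschitz_comp (F := fun p =>
      p.2.1 * Complex.cos (k * ((p.1 - s₀ : ℝ) : ℂ)) -
      p.2.2 / k * Complex.sin (k * ((p.1 - s₀ : ℝ) : ℂ))) (by fun_prop)).eq_of_ae_deriv_eq_zero
    (a := b) (b := b') (by
      filter_upwards [heq] with t ht hmem
      have := ((hy.hasDerivAt t).mul (dcos t)).sub (((ht hmem).div_const k).mul (dsin t))
      refine this.congr_deriv ?_
      field_simp
      ring) hs hs₀
  have E₂ := (hy.locallyLipschitz_comp (F := fun p =>
      p.2.1 * Complex.sin (k * ((p.1 - s₀ : ℝ) : ℂ)) +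
      p.2.2 / k * Complex.cos (k * ((p.1 - s₀ : ℝ) : ℂ))) (by fun_prop)).eq_of_ae_deriv_eq_zero
    (a := b) (b := b') (by
      filter_upwards [heq] with t ht hmem
      have := ((hy.hasDerivAt t).mul (dsin t)).add (((ht hmem).div_const k).mul (dcos t))
      refine this.congr_deriv ?_
      field_simp
      ring) hs hs₀
  simp only [sub_self, Complex.ofReal_zero, mul_zero, Complex.cos_zero, Complex.sin_zero, mul_one,
    sub_zero, zero_add] at E₁ E₂
  have hcs := Complex.sin_sq_add_cos_sq (k * ((s - s₀ : ℝ) : ℂ))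
  -- The data at `s₀` are replaced by the conserved quantities at `s`, so only `sin² + cos² = 1`
  -- remains.
  rw [← E₁, ← E₂]
  set C := Complex.cos (k * ((s - s₀ : ℝ) : ℂ))
  set S := Complex.sin (k * ((s - s₀ : ℝ) : ℂ))
  constructor
  · linear_combination -(y s) * hcs
  · have : deriv y s = k * (deriv y s / k) := by field_simp
    linear_combination this - k * (deriv y s / k) * hcs

theorem cos_sub_mul_I (a e : ℝ) : Complex.cos (a - e * Complex.I) =
    (Real.cos a * Real.cosh e : ℝ) + (Real.sin a * Real.sinh e : ℝ) * Complex.I := by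
  rw [Complex.cos_sub, Complex.cos_mul_I, Complex.sin_mul_I]
  push_cast
  ring

theorem sin_sub_mul_I (a e : ℝ) : Complex.sin (a - e * Complex.I) =
    (Real.sin a * Real.cosh e : ℝ) - (Real.cos a * Real.sinh e : ℝ) * Complex.I := by
  rw [Complex.sin_sub, Complex.cos_mul_I, Complex.sin_mul_I]
  push_cast
  ring

theorem eq_pi_div_of_first_zero {w T : ℝ} (hw : 0 < w) (hT : 0 < T)
    (h0 : Real.sin (2 * (w * T)) = 0)
    (hne : ∀ t ∈ Set.Ioo 0 T, Real.sin (2 * (w * t)) ≠ 0) : T = Real.pi / (2 * w) := by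
  have hp := Real.pi_pos
  rcases lt_trichotomy T (Real.pi / (2 * w)) with hlt | heq | hgt
  · rw [lt_div_iff₀ (by positivity)] at hlt
    exact absurd h0 (Real.sin_pos_of_pos_of_lt_pi (by positivity) (by linarith)).ne'
  · exact heq
  · refine absurd ?_ (hne _ ⟨by positivity, hgt⟩)
    rw [show 2 * (w * (Real.pi / (2 * w))) = Real.pi by field_simp]
    exact Real.sin_pi

/-! ### The function `x` -/

theorem riccati_of_eq_zero {κ : ℂ} {y : ℝ → ℂ} {s : ℝ} (h : y s = 0) :
    riccati κ y s = OnePoint.infty := by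
  simp [riccati, h]

theorem riccati_of_ne_zero {κ : ℂ} {y : ℝ → ℂ} {s : ℝ} (h : y s ≠ 0) :
    riccati κ y s = ((deriv y s / (Complex.I * κ * y s) : ℂ) : OnePoint ℂ) := by
  simp [riccati, h]

theorem eq_zero_of_riccati_eq_infty {κ : ℂ} {y : ℝ → ℂ} {s : ℝ}
    (h : riccati κ y s = OnePoint.infty) : y s = 0 := by
  by_contra h0
  rw [riccati_of_ne_zero h0] at h
  exact OnePoint.coe_ne_infty _ h

theorem deriv_eq_zero_of_riccati_eq_zero {κ : ℂ} (hκ : κ ≠ 0) {y : ℝ → ℂ} {s : ℝ}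
    (h : riccati κ y s = ((0 : ℂ) : OnePoint ℂ)) : deriv y s = 0 := by
  by_cases h0 : y s = 0
  · rw [riccati_of_eq_zero h0] at h
    exact absurd h.symm (OnePoint.coe_ne_infty _)
  · rw [riccati_of_ne_zero h0, OnePoint.coe_eq_coe] at h
    simpa [hκ, h0] using h

theorem riccati_mem_axis_of_re_eq_zero {κ : ℂ} {y : ℝ → ℂ} {s : ℝ}
    (h : (deriv y s / (Complex.I * κ * y s)).re = 0) :
    riccati κ y s ∈ extendedImaginaryAxis := by
  by_cases h0 : y s = 0
  · rw [riccati_of_eq_zero h0]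
    exact Set.mem_insert _ _
  · rw [riccati_of_ne_zero h0]
    refine Set.mem_insert_of_mem _ ⟨(deriv y s / (Complex.I * κ * y s)).im, ?_⟩
    rw [OnePoint.coe_eq_coe]
    exact Complex.ext (by simp [h]) (by simp)

/-! ### The parameters `q` and `q₁` -/

theorem qParam_pos {κ : ℂ} (hre : 0 < κ.re) (him : κ.im < 0) : 0 < qParam κ :=
  neg_pos.mpr (div_neg_of_neg_of_pos him hre)

theorem qOne_eq (κ : ℂ) : qOne κ = (1 + Real.exp (-(qParam κ * Real.pi))) /
    (1 - Real.exp (-(qParam κ * Real.pi))) := by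
  rw [qOne, invI, sub_neg_eq_add, ← sub_eq_add_neg]

theorem one_lt_qOne {κ : ℂ} (hre : 0 < κ.re) (him : κ.im < 0) : 1 < qOne κ := by
  have h1 : Real.exp (-(qParam κ * Real.pi)) < 1 := by
    rw [Real.exp_lt_one_iff]
    have := mul_pos (qParam_pos hre him) Real.pi_pos
    linarith
  rw [qOne_eq, lt_div_iff₀ (by linarith)]
  linarith [Real.exp_pos (-(qParam κ * Real.pi))]

/-- The form `q₁ = coth (qπ/2)` is what the explicit solution produces at the end of a layer, where
`a = π/2` and `e = qπ/2`. -/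
theorem qOne_eq_cosh_div_sinh {κ : ℂ} (hre : 0 < κ.re) (him : κ.im < 0) :
    qOne κ = Real.cosh (qParam κ * Real.pi / 2) / Real.sinh (qParam κ * Real.pi / 2) := by
  have hE : 0 < qParam κ * Real.pi / 2 := by
    have := mul_pos (qParam_pos hre him) Real.pi_pos
    linarith
  have h1 : Real.exp (-(qParam κ * Real.pi)) < 1 := by
    rw [Real.exp_lt_one_iff]; linarith
  rw [qOne_eq, div_eq_div_iff (by linarith) (Real.sinh_pos_iff.mpr hE).ne', Real.cosh_eq,
    Real.sinh_eq]
  have e : Real.exp (-(qParam κ * Real.pi)) = Real.exp (-(qParam κ * Real.pi / 2)) ^ 2 := by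
    rw [← Real.exp_nat_mul]; congr 1; push_cast; ring
  have e2 : Real.exp (qParam κ * Real.pi / 2) * Real.exp (-(qParam κ * Real.pi / 2)) = 1 := by
    rw [← Real.exp_add]; simp
  rw [e]
  linear_combination (Real.exp (-(qParam κ * Real.pi / 2))) * e2

/-! ### Explicit solutions on a layer: quarter-wave and half-wave cases. -/

namespace IsAbnormal

variable {n₁ n₂ : ℝ} {κ : ℂ} {y : ℝ → ℂ}

/-- Keeping `a` and `e` as variables tied by equations allows the values `±π/2` and `±qπ/2` to be
inserted directly at the endpoints. -/
theorem eq_on_layer (h : IsAbnormal n₁ n₂ κ y) {b b' ϵ : ℝ}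
    (hI : IsLayer (feedbackControl n₁ n₂ y) b b')
    (hϵ : Tendsto (feedbackControl n₁ n₂ y) (𝓝[>] b) (𝓝 ϵ)) {s₀ s a e : ℝ}
    (hs₀ : s₀ ∈ Set.Icc b b') (hs : s ∈ Set.Icc b b')
    (ha : a = √ϵ * κ.re * (s - s₀)) (he : e = -(√ϵ * κ.im) * (s - s₀)) :
    y s = y s₀ * ((Real.cos a * Real.cosh e : ℝ) + (Real.sin a * Real.sinh e : ℝ) * Complex.I) +
        deriv y s₀ / (√ϵ * κ) *
          ((Real.sin a * Real.cosh e : ℝ) - (Real.cos a * Real.sinh e : ℝ) * Complex.I) ∧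
      deriv y s = (√ϵ * κ) * (deriv y s₀ / (√ϵ * κ) *
          ((Real.cos a * Real.cosh e : ℝ) + (Real.sin a * Real.sinh e : ℝ) * Complex.I) -
        y s₀ * ((Real.sin a * Real.cosh e : ℝ) - (Real.cos a * Real.sinh e : ℝ) * Complex.I)) := by
  obtain ⟨hpos, hae⟩ := h.ae_control_eq_of_layer hI hϵ
  have hsq : (√ϵ : ℂ) ^ 2 = ϵ := by exact_mod_cast Real.sq_sqrt hpos.le
  have hk : (√ϵ : ℂ) * κ ≠ 0 :=
    mul_ne_zero (by exact_mod_cast (Real.sqrt_pos.mpr hpos).ne') h.kappa_ne_zero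
  have key := h.solution.memW2InfLoc.eq_cos_sin (b := b) (b' := b') hk (by
    filter_upwards [hae, h.solution.equation] with t h1 h2 hm
    refine h2.congr_deriv ?_
    rw [h1 hm, mul_pow, hsq]
    ring) hs₀ hs
  have harg : (√ϵ : ℂ) * κ * ((s - s₀ : ℝ) : ℂ) = a - e * Complex.I := by
    rw [ha, he]
    apply Complex.ext <;> simp
  rwa [harg, cos_sub_mul_I, sin_sub_mul_I] at key

theorem im_sq_eq_zero_of_switch (h : IsAbnormal n₁ n₂ κ y) {b : ℝ}
    (hb : IsSwitchPoint (feedbackControl n₁ n₂ y) b) : (y b ^ 2).im = 0 :=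
  (h.nonzero_of_isSwitchPoint hb).1

/-- At a switch point `x` is real unless it lies on the extended imaginary axis. -/
theorem exists_deriv_eq_of_switch (h : IsAbnormal n₁ n₂ κ y) {b : ℝ}
    (hb : IsSwitchPoint (feedbackControl n₁ n₂ y) b)
    (hx : riccati κ y b ∉ extendedImaginaryAxis) :
    ∃ r : ℝ, deriv y b = Complex.I * κ * y b * r := by
  obtain ⟨hf, h0, h1⟩ := h.nonzero_of_isSwitchPoint hb
  obtain ⟨d, hd⟩ := h.exists_deriv_sq_eq hf
  obtain ⟨c, hc⟩ := exists_eq_ofReal hf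
  have hκ := h.kappa_ne_zero
  have hc0 : (c : ℂ) ≠ 0 := by
    rw [← hc]; exact pow_ne_zero 2 h0
  set z := deriv y b / (Complex.I * κ * y b) with hz
  have hzz : deriv y b = Complex.I * κ * y b * z := by
    rw [hz]; field_simp [Complex.I_ne_zero]
  have hre : z.re ≠ 0 := fun hre => hx (riccati_mem_axis_of_re_eq_zero hre)
  -- `z` is the finite value of `x`. Its square is real, so `z` is real or purely imaginary, and the
  -- latter is excluded by `hx`.
  have hz2 : z ^ 2 = ((-(d / c) : ℝ) : ℂ) := by
    rw [hz, div_pow, mul_pow, mul_pow, hd, hc, Complex.I_sq]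
    push_cast
    field_simp
  have him : (z ^ 2).im = 0 := by rw [hz2]; exact Complex.ofReal_im _
  rw [pow_two, Complex.mul_im] at him
  have : z.im = 0 := by
    have : z.re * z.im = 0 := by linarith
    exact (mul_eq_zero.mp this).resolve_left hre
  obtain ⟨r, hr⟩ := exists_eq_ofReal this
  exact ⟨r, by rw [hzz, hr]⟩

theorem quarter_wave (h : IsAbnormal n₁ n₂ κ y) {b b' ϵ : ℝ}
    (hI : IsLayer (feedbackControl n₁ n₂ y) b b')
    (hϵ : Tendsto (feedbackControl n₁ n₂ y) (𝓝[>] b) (𝓝 ϵ))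
    (hdis : ∀ s ∈ Set.Icc b b', riccati κ y s ∉ extendedImaginaryAxis) :
    b' - b = Real.pi / (2 * (√ϵ * κ.re)) ∧
      ∃ r : ℝ, riccati κ y b = ((r : ℂ) : OnePoint ℂ) ∧ (√ϵ)⁻¹ * qOne κ * r + 1 ≠ 0 ∧
        riccati κ y b' = ((((r + √ϵ * qOne κ) / ((√ϵ)⁻¹ * qOne κ * r + 1) : ℝ) : ℂ) :
          OnePoint ℂ) := by
  have hbm : b ∈ Set.Icc b b' := Set.left_mem_Icc.mpr hI.lt.le
  have hbm' : b' ∈ Set.Icc b b' := Set.right_mem_Icc.mpr hI.lt.le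
  obtain ⟨hpos, -⟩ := h.ae_control_eq_of_layer hI hϵ
  have hsq : 0 < √ϵ := Real.sqrt_pos.mpr hpos
  have hsqc : (√ϵ : ℂ) ≠ 0 := by exact_mod_cast hsq.ne'
  have hκ := h.kappa_ne_zero
  obtain ⟨hf, h0, h1⟩ := h.nonzero_of_isSwitchPoint hI.switch_left
  obtain ⟨r, hr⟩ := h.exists_deriv_eq_of_switch hI.switch_left (hdis b hbm)
  obtain ⟨c, hc⟩ := exists_eq_ofReal hf
  have hc0 : c ≠ 0 := by
    rintro rfl
    exact h0 (by simpa using hc)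
  -- Normalising `x(b) = r` by `√ϵ` removes the refractive index: below, `Im y² = c P R sin 2a` with
  -- `P = cosh e + ρ sinh e` and `R = sinh e + ρ cosh e`.
  set ρ := r / √ϵ with hρ
  have hrρ : r = √ϵ * ρ := by rw [hρ]; field_simp
  have hD : deriv y b / (√ϵ * κ) = y b * (Complex.I * ρ) := by
    rw [hr, hrρ]; push_cast; field_simp
  have form : ∀ s ∈ Set.Icc b b', ∀ a e : ℝ, a = √ϵ * κ.re * (s - b) →
      e = -(√ϵ * κ.im) * (s - b) →
      y s = y b * ((Real.cos a * (Real.cosh e + ρ * Real.sinh e) : ℝ) +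
        (Real.sin a * (Real.sinh e + ρ * Real.cosh e) : ℝ) * Complex.I) ∧
      deriv y s = Complex.I * κ * √ϵ * y b *
        ((Real.cos a * (Real.sinh e + ρ * Real.cosh e) : ℝ) +
        (Real.sin a * (Real.cosh e + ρ * Real.sinh e) : ℝ) * Complex.I) := by
    intro s hs a e ha he
    obtain ⟨e1, e2⟩ := h.eq_on_layer hI hϵ hbm hs ha he
    rw [hD] at e1 e2
    constructor
    · rw [e1]
      push_cast
      linear_combination (-(y b * ρ * Complex.cos a * Complex.sinh e)) * Complex.I_sq
    · rw [e2]
      push_cast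
      linear_combination (-(y b * √ϵ * κ * Complex.sin a * Complex.cosh e)) * Complex.I_sq
  have hfsin : ∀ s ∈ Set.Icc b b', Real.sin (2 * (√ϵ * κ.re * (s - b))) = 0 →
      (y s ^ 2).im = 0 := by
    intro s hs hsin
    rw [(form s hs _ _ rfl rfl).1, mul_pow, hc, Complex.im_ofReal_mul, pow_two, Complex.mul_im]
    rw [Real.sin_two_mul] at hsin
    simp only [Complex.add_im, Complex.add_re, Complex.mul_I_im, Complex.mul_I_re,
      Complex.ofReal_re, Complex.ofReal_im]
    linear_combination c * (Real.cosh _ + ρ * Real.sinh _) *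
      (Real.sinh _ + ρ * Real.cosh _) * hsin
  have hT : b' - b = Real.pi / (2 * (√ϵ * κ.re)) := by
    refine eq_pi_div_of_first_zero (mul_pos hsq h.re_pos) (sub_pos.mpr hI.lt) ?_ ?_
    · have hfb' := h.im_sq_eq_zero_of_switch hI.switch_right
      have hx' := hdis b' hbm'
      obtain ⟨f1, f2⟩ := form b' hbm' _ _ rfl rfl
      set a := √ϵ * κ.re * (b' - b)
      set e := -(√ϵ * κ.im) * (b' - b)
      set P := Real.cosh e + ρ * Real.sinh e with hP
      set R := Real.sinh e + ρ * Real.cosh e with hR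
      -- The numerator of `Re x(b')` is, up to the factor `√ϵ`, `(cos² a + sin² a) P R`. If `P R =
      -- 0`, then `x(b')` lies on the extended imaginary axis.
      have hPR : P * R ≠ 0 := by
        intro hPR
        apply hx'
        apply riccati_mem_axis_of_re_eq_zero
        have hval : deriv y b' / (Complex.I * κ * y b') = (√ϵ : ℂ) *
            (((Real.cos a * R : ℝ) + (Real.sin a * P : ℝ) * Complex.I) /
            ((Real.cos a * P : ℝ) + (Real.sin a * R : ℝ) * Complex.I)) := by
          rw [f1, f2]
          field_simp [Complex.I_ne_zero]
        rw [hval, Complex.re_ofReal_mul, Complex.div_re]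
        simp only [Complex.add_im, Complex.add_re, Complex.mul_I_im, Complex.mul_I_re,
          Complex.ofReal_re, Complex.ofReal_im]
        rw [← add_div]
        refine mul_eq_zero_of_right _ (div_eq_zero_iff.mpr (Or.inl ?_))
        linear_combination (Real.cos a ^ 2 + Real.sin a ^ 2) * hPR
      rw [f1, mul_pow, hc, Complex.im_ofReal_mul, pow_two, Complex.mul_im] at hfb'
      simp only [Complex.add_im, Complex.add_re, Complex.mul_I_im, Complex.mul_I_re,
        Complex.ofReal_re, Complex.ofReal_im] at hfb'
      have : c * (P * R) * Real.sin (2 * a) = 0 := by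
        rw [Real.sin_two_mul]
        linear_combination hfb'
      exact (mul_eq_zero.mp this).resolve_left (mul_ne_zero hc0 hPR)
    -- An earlier zero of `sin 2a` would be an interior zero of `Im y²`, where `y` or `y'` vanishes
    -- and `x` is `∞` or `0`, again on the axis.
    · intro t ht hsin
      have hm : b + t ∈ Set.Ioo b b' := ⟨by linarith [ht.1], by linarith [ht.2]⟩
      have hm' := Set.Ioo_subset_Icc_self hm
      have := hfsin (b + t) hm' (by rwa [add_sub_cancel_left])
      refine hdis _ hm' (riccati_mem_axis_of_re_eq_zero ?_)
      rcases h.eq_zero_or_deriv_eq_zero_of_mem_layer hI hm this with hz | hz <;> simp [hz]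
  refine ⟨hT, r, ?_, ?_⟩
  · rw [riccati_of_ne_zero h0, hr]
    congr 1
    field_simp [Complex.I_ne_zero]
  have hre := h.re_pos
  have ha : Real.pi / 2 = √ϵ * κ.re * (b' - b) := by rw [hT]; field_simp
  have he : qParam κ * Real.pi / 2 = -(√ϵ * κ.im) * (b' - b) := by
    rw [hT, qParam]; field_simp
  obtain ⟨f1, f2⟩ := form b' hbm' _ _ ha he
  have hy' := (h.nonzero_of_isSwitchPoint hI.switch_right).2.1
  have hE : 0 < qParam κ * Real.pi / 2 := by
    have := mul_pos (qParam_pos h.re_pos h.im_neg) Real.pi_pos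
    linarith
  have hsinh := Real.sinh_pos_iff.mpr hE
  rw [qOne_eq_cosh_div_sinh h.re_pos h.im_neg]
  set ch := Real.cosh (qParam κ * Real.pi / 2)
  set sh := Real.sinh (qParam κ * Real.pi / 2)
  rw [Real.cos_pi_div_two, Real.sin_pi_div_two, zero_mul, one_mul, Complex.ofReal_zero,
    zero_add] at f1 f2
  -- At `a = π/2` this is the only surviving factor of `y(b') / y(b)`, and `y` does not vanish at a
  -- switch point.
  have hden : sh + ρ * ch ≠ 0 := by
    intro hd
    rw [hd] at f1
    exact hy' (by simpa using f1)
  have hdenc : ((sh + ρ * ch : ℝ) : ℂ) ≠ 0 := by exact_mod_cast hden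
  have hd1 : (√ϵ)⁻¹ * (ch / sh) * r + 1 = (sh + ρ * ch) / sh := by
    rw [hrρ]; field_simp; ring
  have hd2 : r + √ϵ * (ch / sh) = √ϵ * ((ch + ρ * sh) / sh) := by
    rw [hrρ]; field_simp; ring
  refine ⟨by rw [hd1]; exact div_ne_zero hden hsinh.ne', ?_⟩
  rw [riccati_of_ne_zero hy', f1, f2, hd1, hd2, ← mul_div_assoc,
    div_div_div_cancel_right₀ hsinh.ne']
  congr 1
  rw [Complex.ofReal_div, Complex.ofReal_mul]
  field_simp [Complex.I_ne_zero]

/-- If `Im y²` is a multiple of `sin 2a sinh 2e` on a layer, the layer is a half-wave layer. -/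
theorem half_wave_length (h : IsAbnormal n₁ n₂ κ y) {b b' ϵ : ℝ}
    (hI : IsLayer (feedbackControl n₁ n₂ y) b b') (hϵ : 0 < ϵ) {s₀ c : ℝ}
    (hs₀ : s₀ ∈ Set.Icc b b') (hc : c ≠ 0) (hend : y s₀ = 0 ∨ deriv y s₀ = 0)
    (hform : ∀ s ∈ Set.Icc b b', (y s ^ 2).im = c * Real.sin (2 * (√ϵ * κ.re * (s - s₀))) *
      Real.sinh (2 * (-(√ϵ * κ.im) * (s - s₀))))
    (hzero : ∀ s ∈ Set.Icc b b', y s = 0 ∨ deriv y s = 0 → s = s₀) :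
    s₀ - b = Real.pi / (2 * (√ϵ * κ.re)) ∧ b' - s₀ = Real.pi / (2 * (√ϵ * κ.re)) := by
  have hsq : 0 < √ϵ := Real.sqrt_pos.mpr hϵ
  have hbm : b ∈ Set.Icc b b' := Set.left_mem_Icc.mpr hI.lt.le
  have hbm' : b' ∈ Set.Icc b b' := Set.right_mem_Icc.mpr hI.lt.le
  have hb := h.nonzero_of_isSwitchPoint hI.switch_left
  have hb' := h.nonzero_of_isSwitchPoint hI.switch_right
  -- At a switch point neither `y` nor `y'` vanishes, so `s₀` is not an endpoint.
  have hlt : b < s₀ := lt_of_le_of_ne hs₀.1 (by rintro rfl; tauto)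
  have hlt' : s₀ < b' := lt_of_le_of_ne hs₀.2 (by rintro rfl; tauto)
  have hw := mul_pos hsq h.re_pos
  have hv : 0 < -(√ϵ * κ.im) := neg_pos.mpr (mul_neg_of_pos_of_neg hsq h.im_neg)
  have hsin : ∀ s ∈ Set.Icc b b', s ≠ s₀ → (y s ^ 2).im = 0 →
      Real.sin (2 * (√ϵ * κ.re * (s - s₀))) = 0 := by
    intro s hs hne h0
    rw [hform s hs] at h0
    have hsh : Real.sinh (2 * (-(√ϵ * κ.im) * (s - s₀))) ≠ 0 := by
      rw [Ne, Real.sinh_eq_zero]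
      exact mul_ne_zero two_ne_zero (mul_ne_zero hv.ne' (sub_ne_zero.mpr hne))
    exact (mul_eq_zero.mp ((mul_eq_zero.mp h0).resolve_right hsh)).resolve_left hc
  -- Any interior zero of `Im y²` is a zero of `y` or `y'`, hence `s₀` itself. So the endpoints are
  -- the first zeros of `sin 2a` on either side of `s₀`.
  have hint : ∀ s ∈ Set.Ioo b b', s ≠ s₀ → Real.sin (2 * (√ϵ * κ.re * (s - s₀))) ≠ 0 := by
    intro s hs hne h0
    refine hne (hzero s (Set.Ioo_subset_Icc_self hs)
      (h.eq_zero_or_deriv_eq_zero_of_mem_layer hI hs ?_))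
    rw [hform s (Set.Ioo_subset_Icc_self hs), h0]
    ring
  have hodd : ∀ s, Real.sin (2 * (√ϵ * κ.re * (s₀ - s))) =
      -Real.sin (2 * (√ϵ * κ.re * (s - s₀))) := fun s => by
    rw [← Real.sin_neg]; congr 1; ring
  constructor
  · refine eq_pi_div_of_first_zero hw (sub_pos.mpr hlt) ?_ fun t ht h0 => ?_
    · rw [hodd, hsin b hbm hlt.ne hb.1, neg_zero]
    · refine hint (s₀ - t) ⟨by linarith [ht.2], by linarith [ht.1]⟩ (by linarith [ht.1]) ?_
      rw [← neg_eq_zero, ← hodd, sub_sub_cancel, h0]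
  · refine eq_pi_div_of_first_zero hw (sub_pos.mpr hlt') (hsin b' hbm' hlt'.ne' hb'.1)
      fun t ht h0 => ?_
    refine hint (s₀ + t) ⟨by linarith [ht.1], by linarith [ht.2]⟩ (by linarith [ht.1]) ?_
    rwa [add_sub_cancel_left]

/-- The alternatives say that the complex sine, respectively cosine, vanishes at `(w - i v)(s -
s₀)`. All zeros of these functions are real, and this argument is nonreal unless `s = s₀`. -/
theorem eq_of_trig_eq_zero {v w s s₀ : ℝ} (hv : 0 < v)
    (h : Real.cos (w * (s - s₀)) * Real.sinh (v * (s - s₀)) = 0 ∧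
      Real.sin (w * (s - s₀)) * Real.cosh (v * (s - s₀)) = 0 ∨
      Real.cos (w * (s - s₀)) * Real.cosh (v * (s - s₀)) = 0 ∧
      Real.sin (w * (s - s₀)) * Real.sinh (v * (s - s₀)) = 0) : s = s₀ := by
  have hch := (Real.cosh_pos (v * (s - s₀))).ne'
  have hcs := Real.sin_sq_add_cos_sq (w * (s - s₀))
  have hsh : Real.sinh (v * (s - s₀)) = 0 := by
    rcases h with ⟨h1, h2⟩ | ⟨h1, h2⟩
    · have h3 := (mul_eq_zero.mp h2).resolve_right hch
      refine (mul_eq_zero.mp h1).resolve_left fun h4 => ?_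
      rw [h3, h4] at hcs
      norm_num at hcs
    · have h3 := (mul_eq_zero.mp h1).resolve_right hch
      refine (mul_eq_zero.mp h2).resolve_left fun h4 => ?_
      rw [h3, h4] at hcs
      norm_num at hcs
  rw [Real.sinh_eq_zero] at hsh
  linarith [(mul_eq_zero.mp hsh).resolve_left hv.ne']

theorem eq_zero_of_ofReal_add_mul_I {p q : ℝ} (h : (p : ℂ) + q * Complex.I = 0) :
    p = 0 ∧ q = 0 := by
  have h1 := congrArg Complex.re h
  have h2 := congrArg Complex.im h
  simp at h1 h2
  exact ⟨h1, h2⟩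

theorem half_wave_parameters (h : IsAbnormal n₁ n₂ κ y) {ϵ T : ℝ} (hϵ : 0 < ϵ)
    (hT : T = Real.pi / (2 * (√ϵ * κ.re))) :
    Real.pi / 2 = √ϵ * κ.re * T ∧ qParam κ * Real.pi / 2 = -(√ϵ * κ.im) * T := by
  have hsq : 0 < √ϵ := Real.sqrt_pos.mpr hϵ
  have hre := h.re_pos
  rw [hT, qParam]
  constructor <;> field_simp

theorem half_wave_of_eq_zero (h : IsAbnormal n₁ n₂ κ y) {b b' ϵ : ℝ}
    (hI : IsLayer (feedbackControl n₁ n₂ y) b b')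
    (hϵ : Tendsto (feedbackControl n₁ n₂ y) (𝓝[>] b) (𝓝 ϵ)) {s₀ : ℝ}
    (hs₀ : s₀ ∈ Set.Icc b b') (h0 : y s₀ = 0) :
    (s₀ - b = Real.pi / (2 * (√ϵ * κ.re)) ∧ b' - s₀ = Real.pi / (2 * (√ϵ * κ.re))) ∧
      riccati κ y b' = (((√ϵ / qOne κ : ℝ) : ℂ) : OnePoint ℂ) ∧
      riccati κ y b = (((-(√ϵ / qOne κ) : ℝ) : ℂ) : OnePoint ℂ) := by
  obtain ⟨hpos, -⟩ := h.ae_control_eq_of_layer hI hϵ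
  have hsq : 0 < √ϵ := Real.sqrt_pos.mpr hpos
  have hsqc : (√ϵ : ℂ) ≠ 0 := by exact_mod_cast hsq.ne'
  have hκ := h.kappa_ne_zero
  have hv : 0 < -(√ϵ * κ.im) := neg_pos.mpr (mul_neg_of_pos_of_neg hsq h.im_neg)
  obtain ⟨d, hd⟩ := h.exists_deriv_sq_eq (s := s₀) (by simp [h0])
  have h1 := h.solution.state_ne_zero h.pos h.lt h0
  have hd0 : d ≠ 0 := by
    rintro rfl
    exact h1 (by simpa using hd)
  set D := deriv y s₀ / (√ϵ * κ) with hD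
  have hD0 : D ≠ 0 := div_ne_zero h1 (mul_ne_zero hsqc hκ)
  have hD2 : D ^ 2 = ((d / ϵ : ℝ) : ℂ) := by
    have : (√ϵ : ℂ) ^ 2 = ϵ := by exact_mod_cast Real.sq_sqrt hpos.le
    rw [hD, div_pow, mul_pow, this, hd]
    push_cast
    field_simp
  have form : ∀ s ∈ Set.Icc b b', ∀ a e : ℝ, a = √ϵ * κ.re * (s - s₀) →
      e = -(√ϵ * κ.im) * (s - s₀) →
      y s = D * ((Real.sin a * Real.cosh e : ℝ) + (-(Real.cos a * Real.sinh e) : ℝ) * Complex.I) ∧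
      deriv y s = √ϵ * κ * D *
        ((Real.cos a * Real.cosh e : ℝ) + (Real.sin a * Real.sinh e : ℝ) * Complex.I) := by
    intro s hs a e ha he
    obtain ⟨e1, e2⟩ := h.eq_on_layer hI hϵ hs₀ hs ha he
    rw [h0] at e1 e2
    constructor
    · rw [e1]; push_cast; ring
    · rw [e2]; push_cast; ring
  -- Here `y = D sin (a - i e)` with `D² = d/ϵ` real, so `Im y² = -2 D² sin a cos a sinh e cosh e`;
  -- the double-angle formulas give the constant.
  obtain ⟨hl, hr⟩ := h.half_wave_length hI hpos (c := -(d / ϵ) / 2) hs₀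
    (div_ne_zero (neg_ne_zero.mpr (div_ne_zero hd0 hpos.ne')) two_ne_zero) (Or.inl h0)
    (fun s hs => by
      rw [(form s hs _ _ rfl rfl).1, mul_pow, hD2, Complex.im_ofReal_mul, pow_two, Complex.mul_im]
      simp only [Complex.add_im, Complex.add_re, Complex.mul_I_im, Complex.mul_I_re,
        Complex.ofReal_re, Complex.ofReal_im]
      rw [Real.sin_two_mul, Real.sinh_two_mul]
      ring)
    (fun s hs hz => by
      obtain ⟨f1, f2⟩ := form s hs _ _ rfl rfl
      refine eq_of_trig_eq_zero (w := √ϵ * κ.re) hv ?_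
      rcases hz with hz | hz
      · left
        rw [f1] at hz
        obtain ⟨p, q⟩ := eq_zero_of_ofReal_add_mul_I ((mul_eq_zero.mp hz).resolve_left hD0)
        exact ⟨neg_eq_zero.mp q, p⟩
      · right
        rw [f2] at hz
        exact eq_zero_of_ofReal_add_mul_I ((mul_eq_zero.mp hz).resolve_left
          (mul_ne_zero (mul_ne_zero hsqc hκ) hD0)))
  refine ⟨⟨hl, hr⟩, ?_⟩
  have hE : 0 < qParam κ * Real.pi / 2 := by
    have := mul_pos (qParam_pos h.re_pos h.im_neg) Real.pi_pos
    linarith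
  have hsinh := Real.sinh_pos_iff.mpr hE
  have hcosh := Real.cosh_pos (qParam κ * Real.pi / 2)
  obtain ⟨pl1, pl2⟩ := h.half_wave_parameters hpos hl
  obtain ⟨pr1, pr2⟩ := h.half_wave_parameters hpos hr
  obtain ⟨f1, f2⟩ := form b' (Set.right_mem_Icc.mpr hI.lt.le) _ _ pr1 pr2
  -- The left end is the mirror image of the right one, with both `a` and `e` negated; `y` is odd
  -- and `y'` even about `s₀`, whence `x(b) = -x(b')`.
  obtain ⟨g1, g2⟩ := form b (Set.left_mem_Icc.mpr hI.lt.le) (-(Real.pi / 2))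
    (-(qParam κ * Real.pi / 2)) (by rw [pl1]; ring) (by rw [pl2]; ring)
  rw [riccati_of_ne_zero (h.nonzero_of_isSwitchPoint hI.switch_left).2.1,
    riccati_of_ne_zero (h.nonzero_of_isSwitchPoint hI.switch_right).2.1, f1, f2, g1, g2,
    qOne_eq_cosh_div_sinh h.re_pos h.im_neg]
  simp only [Real.cos_neg, Real.sin_neg, Real.cosh_neg, Real.sinh_neg, Real.cos_pi_div_two,
    Real.sin_pi_div_two, zero_mul, one_mul, neg_zero, Complex.ofReal_zero, zero_add, add_zero,
    neg_mul, neg_neg]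
  set ch := Real.cosh (qParam κ * Real.pi / 2)
  set sh := Real.sinh (qParam κ * Real.pi / 2)
  have hchc : (ch : ℂ) ≠ 0 := by exact_mod_cast hcosh.ne'
  have hshc : (sh : ℂ) ≠ 0 := by exact_mod_cast hsinh.ne'
  constructor <;> congr 1 <;> push_cast <;> field_simp [Complex.I_ne_zero]

theorem half_wave_of_deriv_eq_zero (h : IsAbnormal n₁ n₂ κ y) {b b' ϵ : ℝ}
    (hI : IsLayer (feedbackControl n₁ n₂ y) b b')
    (hϵ : Tendsto (feedbackControl n₁ n₂ y) (𝓝[>] b) (𝓝 ϵ)) {s₀ : ℝ}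
    (hs₀ : s₀ ∈ Set.Icc b b') (h1 : deriv y s₀ = 0) :
    (s₀ - b = Real.pi / (2 * (√ϵ * κ.re)) ∧ b' - s₀ = Real.pi / (2 * (√ϵ * κ.re))) ∧
      riccati κ y b' = (((√ϵ * qOne κ : ℝ) : ℂ) : OnePoint ℂ) ∧
      riccati κ y b = (((-(√ϵ * qOne κ) : ℝ) : ℂ) : OnePoint ℂ) := by
  obtain ⟨hpos, -⟩ := h.ae_control_eq_of_layer hI hϵ
  have hsq : 0 < √ϵ := Real.sqrt_pos.mpr hpos
  have hsqc : (√ϵ : ℂ) ≠ 0 := by exact_mod_cast hsq.ne'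
  have hκ := h.kappa_ne_zero
  have hv : 0 < -(√ϵ * κ.im) := neg_pos.mpr (mul_neg_of_pos_of_neg hsq h.im_neg)
  obtain ⟨c, hc⟩ := exists_eq_ofReal (h.im_sq_eq_zero_of_deriv h1)
  have h0 : y s₀ ≠ 0 := fun h0 => h.solution.state_ne_zero h.pos h.lt h0 h1
  have hc0 : c ≠ 0 := by
    rintro rfl
    exact h0 (by simpa using hc)
  have form : ∀ s ∈ Set.Icc b b', ∀ a e : ℝ, a = √ϵ * κ.re * (s - s₀) →
      e = -(√ϵ * κ.im) * (s - s₀) →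
      y s = y s₀ *
        ((Real.cos a * Real.cosh e : ℝ) + (Real.sin a * Real.sinh e : ℝ) * Complex.I) ∧
      deriv y s = -(√ϵ * κ * y s₀) *
        ((Real.sin a * Real.cosh e : ℝ) + (-(Real.cos a * Real.sinh e) : ℝ) * Complex.I) := by
    intro s hs a e ha he
    obtain ⟨e1, e2⟩ := h.eq_on_layer hI hϵ hs₀ hs ha he
    rw [h1] at e1 e2
    constructor
    · rw [e1]; push_cast; ring
    · rw [e2]; push_cast; ring
  -- Now `y = y(s₀) cos (a - i e)` with `y(s₀)² = c`, so `Im y² = 2 c sin a cos a sinh e cosh e`.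
  obtain ⟨hl, hr⟩ := h.half_wave_length hI hpos (c := c / 2) hs₀
    (div_ne_zero hc0 two_ne_zero) (Or.inr h1)
    (fun s hs => by
      rw [(form s hs _ _ rfl rfl).1, mul_pow, hc, Complex.im_ofReal_mul, pow_two, Complex.mul_im]
      simp only [Complex.add_im, Complex.add_re, Complex.mul_I_im, Complex.mul_I_re,
        Complex.ofReal_re, Complex.ofReal_im]
      rw [Real.sin_two_mul, Real.sinh_two_mul]
      ring)
    (fun s hs hz => by
      obtain ⟨f1, f2⟩ := form s hs _ _ rfl rfl
      refine eq_of_trig_eq_zero (w := √ϵ * κ.re) hv ?_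
      rcases hz with hz | hz
      · right
        rw [f1] at hz
        exact eq_zero_of_ofReal_add_mul_I ((mul_eq_zero.mp hz).resolve_left h0)
      · left
        rw [f2] at hz
        obtain ⟨p, q⟩ := eq_zero_of_ofReal_add_mul_I ((mul_eq_zero.mp hz).resolve_left
          (neg_ne_zero.mpr (mul_ne_zero (mul_ne_zero hsqc hκ) h0)))
        exact ⟨neg_eq_zero.mp q, p⟩)
  refine ⟨⟨hl, hr⟩, ?_⟩
  have hE : 0 < qParam κ * Real.pi / 2 := by
    have := mul_pos (qParam_pos h.re_pos h.im_neg) Real.pi_pos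
    linarith
  have hsinh := Real.sinh_pos_iff.mpr hE
  have hcosh := Real.cosh_pos (qParam κ * Real.pi / 2)
  obtain ⟨pl1, pl2⟩ := h.half_wave_parameters hpos hl
  obtain ⟨pr1, pr2⟩ := h.half_wave_parameters hpos hr
  obtain ⟨f1, f2⟩ := form b' (Set.right_mem_Icc.mpr hI.lt.le) _ _ pr1 pr2
  obtain ⟨g1, g2⟩ := form b (Set.left_mem_Icc.mpr hI.lt.le) (-(Real.pi / 2))
    (-(qParam κ * Real.pi / 2)) (by rw [pl1]; ring) (by rw [pl2]; ring)
  rw [riccati_of_ne_zero (h.nonzero_of_isSwitchPoint hI.switch_left).2.1,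
    riccati_of_ne_zero (h.nonzero_of_isSwitchPoint hI.switch_right).2.1, f1, f2, g1, g2,
    qOne_eq_cosh_div_sinh h.re_pos h.im_neg]
  simp only [Real.cos_neg, Real.sin_neg, Real.cosh_neg, Real.sinh_neg, Real.cos_pi_div_two,
    Real.sin_pi_div_two, zero_mul, one_mul, neg_zero, Complex.ofReal_zero, zero_add, add_zero,
    neg_mul, neg_neg, mul_neg]
  set ch := Real.cosh (qParam κ * Real.pi / 2)
  set sh := Real.sinh (qParam κ * Real.pi / 2)
  have hchc : (ch : ℂ) ≠ 0 := by exact_mod_cast hcosh.ne'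
  have hshc : (sh : ℂ) ≠ 0 := by exact_mod_cast hsinh.ne'
  constructor <;> congr 1 <;> push_cast <;> field_simp [Complex.I_ne_zero] <;>
    simp [Complex.I_sq]

end IsAbnormal

/-! ### Invertibility of the transfer matrix and the main theorem. -/

/-- The factors `√ϵ` cancel in the determinant, which is `1 - q₁² < 0`. -/
theorem transferMatrix_det_ne_zero {κ : ℂ} (hre : 0 < κ.re) (him : κ.im < 0) {ϵ : ℝ}
    (hϵ : 0 < ϵ) : (transferMatrix κ ϵ).det ≠ 0 := by
  have h1 := one_lt_qOne hre him
  have hsq : 0 < √ϵ := Real.sqrt_pos.mpr hϵ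
  rw [transferMatrix, Matrix.det_fin_two_of, ← Complex.ofReal_mul, mul_one, ← Complex.ofReal_one,
    ← Complex.ofReal_sub, Complex.ofReal_ne_zero]
  have e : √ϵ * qOne κ * ((√ϵ)⁻¹ * qOne κ) = qOne κ ^ 2 := by field_simp
  rw [e]
  nlinarith

end LayeredResonator

theorem theorem5p5
    (n₁ n₂ : ℝ) (hn₁ : 0 < n₁) (hn₂ : n₁ < n₂)
    (κ : ℂ) (hκre : 0 < κ.re) (hκim : κ.im < 0)
    (x : ℝ → OnePoint ℂ) (ε : ℝ → ℝ) (y : ℝ → ℂ)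
    (hext : LayeredResonator.IsExtendedExtremalTuple n₁ n₂ κ x ε 0 y)
    (b b' : ℝ) (hlayer : LayeredResonator.IsLayer ε b b')
    (ϵ : ℝ) (hϵ : Tendsto ε (𝓝[>] b) (𝓝 ϵ)) :
    -- the value of `q₁`
    (LayeredResonator.qOne κ =
        (1 + Real.exp (-(LayeredResonator.qParam κ * Real.pi))) /
          (1 - Real.exp (-(LayeredResonator.qParam κ * Real.pi))) ∧
      1 < LayeredResonator.qOne κ) ∧
    -- (i) quarter-wave layers
    (Disjoint (x '' Set.Icc b b') LayeredResonator.extendedImaginaryAxis →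
      b' - b = Real.pi / (2 * √ϵ * κ.re) ∧
      ∃ g : Matrix.GeneralLinearGroup (Fin 2) ℂ,
        (g : Matrix (Fin 2) (Fin 2) ℂ) = LayeredResonator.transferMatrix κ ϵ ∧
        x b' = g • x b) ∧
    -- (ii) half-wave layers
    (∀ s₀ ∈ Set.Icc b b',
      x s₀ = ((0 : ℂ) : OnePoint ℂ) ∨ x s₀ = OnePoint.infty →
        s₀ = (b + b') / 2 ∧
        b' - b = Real.pi / (√ϵ * κ.re) ∧
        (x s₀ = OnePoint.infty →
          ∃ r : ℝ, r ∈ Set.Ioo 0 √ϵ ∧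
            x b' = (((r : ℝ) : ℂ) : OnePoint ℂ) ∧ x b = (((-r : ℝ) : ℂ) : OnePoint ℂ)) ∧
        (x s₀ = ((0 : ℂ) : OnePoint ℂ) →
          ∃ r : ℝ, r ∈ Set.Ioi √ϵ ∧
            x b' = (((r : ℝ) : ℂ) : OnePoint ℂ) ∧ x b = (((-r : ℝ) : ℂ) : OnePoint ℂ))) := by
  open LayeredResonator in
  obtain ⟨hsol, rfl, rfl, -, hmul⟩ := hext
  have h : IsAbnormal n₁ n₂ κ y := ⟨hn₁, hn₂, hκre, hκim, hsol, hmul⟩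
  obtain ⟨hpos, -⟩ := h.ae_control_eq_of_layer hlayer hϵ
  have hsq : 0 < √ϵ := Real.sqrt_pos.mpr hpos
  have hq := one_lt_qOne hκre hκim
  refine ⟨⟨qOne_eq κ, hq⟩, fun hdis => ?_, fun s₀ hs₀ hx => ?_⟩
  · obtain ⟨hT, r, hr, hne, hr'⟩ := h.quarter_wave hlayer hϵ fun s hs =>
      Set.disjoint_left.mp hdis (Set.mem_image_of_mem _ hs)
    refine ⟨by rw [hT, mul_assoc], ?_⟩
    obtain ⟨g, hg⟩ : ∃ g : Matrix.GeneralLinearGroup (Fin 2) ℂ,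
        (g : Matrix (Fin 2) (Fin 2) ℂ) = transferMatrix κ ϵ :=
      ⟨Matrix.GeneralLinearGroup.mkOfDetNeZero _
        (transferMatrix_det_ne_zero hκre hκim hpos), rfl⟩
    refine ⟨g, hg, ?_⟩
    have hne' : (((√ϵ)⁻¹ * qOne κ : ℝ) : ℂ) * r + 1 ≠ 0 := by exact_mod_cast hne
    -- The Möbius action sends a finite point to `∞` exactly when its denominator vanishes; `hne'`
    -- excludes that branch.
    rw [hr, hr', OnePoint.smul_some_eq_ite, hg]
    have e00 : transferMatrix κ ϵ 0 0 = 1 := rfl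
    have e01 : transferMatrix κ ϵ 0 1 = ((√ϵ * qOne κ : ℝ) : ℂ) := rfl
    have e10 : transferMatrix κ ϵ 1 0 = (((√ϵ)⁻¹ * qOne κ : ℝ) : ℂ) := rfl
    have e11 : transferMatrix κ ϵ 1 1 = 1 := rfl
    rw [e00, e01, e10, e11, if_neg hne', one_mul]
    push_cast
    rfl
  · have hmid : ∀ {T : ℝ}, s₀ - b = Real.pi / (2 * T) ∧ b' - s₀ = Real.pi / (2 * T) →
        s₀ = (b + b') / 2 ∧ b' - b = Real.pi / T := by
      rintro T ⟨h1, h2⟩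
      have e : Real.pi / T = Real.pi / (2 * T) + Real.pi / (2 * T) := by
        rw [← add_div, ← two_mul, mul_div_mul_left _ _ two_ne_zero]
      exact ⟨by linarith, by linarith⟩
    have hlen : s₀ = (b + b') / 2 ∧ b' - b = Real.pi / (√ϵ * κ.re) := by
      rcases hx with hx | hx
      · exact hmid (h.half_wave_of_deriv_eq_zero hlayer hϵ hs₀
          (deriv_eq_zero_of_riccati_eq_zero h.kappa_ne_zero hx)).1
      · exact hmid (h.half_wave_of_eq_zero hlayer hϵ hs₀ (eq_zero_of_riccati_eq_infty hx)).1
    refine ⟨hlen.1, hlen.2, fun hx => ?_, fun hx => ?_⟩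
    · refine ⟨√ϵ / qOne κ, ⟨by positivity, div_lt_self hsq hq⟩, ?_⟩
      exact (h.half_wave_of_eq_zero hlayer hϵ hs₀ (eq_zero_of_riccati_eq_infty hx)).2
    · refine ⟨√ϵ * qOne κ, lt_mul_of_one_lt_right hsq hq, ?_⟩
      exact (h.half_wave_of_deriv_eq_zero hlayer hϵ hs₀
        (deriv_eq_zero_of_riccati_eq_zero h.kappa_ne_zero hx)).2
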